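/- Let $G=(V,E)$ be a finite simple graph on $n$ vertices, $q\ge 2$ an integer, $\beta>0$ and $p=1-e^{-\beta}$. The $q$-state Potts measure on $\{1,\dots,q\}^V$ is $\pi(\sigma)\propto e^{\beta|E_m(\sigma)|}$, where $E_m(\sigma)=\{uv\in E:\sigma(u)=\sigma(v)\}$. The Swendsen–Wang dynamics $(X_t)_{t=0,1,2,\dots}$ is the Markov chain on $\{1,\dots,q\}^V$ that moves from $\sigma$ as follows: keep each edge of $E_m(\sigma)$ independently with probability $p$ to get an edge set $\omega$; then give each connected component of $(V,\omega)$ (isolated vertices included) an independent uniform colour in $\{1,\dots,q\}$. It is reversible with respect to $\pi$. Let $1=\lambda_1\ge\lambda_2\ge\dots\ge\lambda_{q^n}$ be the eigenvalues of its transition matrix, listed with multiplicity, and let $\gamma=1-\max\{\lambda_2,|\lambda_{q^n}|\}$ be its spectral gap. For a probability measure $\mu$ put $\|\mu-\pi\|_{L^2(\pi)}=\big(\sum_\sigma (\mu(\sigma)/\pi(\sigma)-1)^2\pi(\sigma)\big)^{1/2}$. **Theorem.** For every integer $d\ge 2$ there is a constant $p_0=p_0(d)>0$ such that for every $p\in(0,p_0)$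 with $p<1$ there is a constant $C=C(d,p)>0$ for which the following holds. For every integer $q\ge2$ there is $N=N(d,p,q)$ such that for every $n\ge N$, every $d$-regular vertex-transitive graph $G$ on $n$ vertices, and every integer $t\ge C\log n$, $$\max_{x_0\in\{1,\dots,q\}^V}\big\|\mathbb P_{x_0}(X_t\in\cdot)-\pi\big\|_{L^2(\pi)}\;\le\; 2\exp\Big(-\log\Big(\frac1{1-\gamma}\Big)\,(t-C\log n)\Big).$$ -/

import Mathlib

namespace SwendsenWang

open SimpleGraph

/-- `G` is (vertex-)transitive: any vertex is mapped to any other by an automorphism of `G`. -/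
def IsTransitive {V : Type*} (G : SimpleGraph V) : Prop :=
  ∀ u v : V, ∃ f : G ≃g G, f u = v

section Model

variable {V : Type*} [Fintype V] [DecidableEq V] (G : SimpleGraph V) [DecidableRel G.Adj] {q : ℕ}

/-- The set of monochromatic edges of a colouring `σ`: the edges `uv` of `G` with `σ u = σ v`. -/
def monoEdges (σ : V → Fin q) : Finset (Sym2 V) :=
  G.edgeFinset.filter fun e => (e.map σ).IsDiag

/-- The unnormalised weight `exp (β |E_m(σ)|)` of the Potts model. -/
noncomputable def pottsWeight (β : ℝ) (σ : V → Fin q) : ℝ :=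
  Real.exp (β * ((monoEdges G σ).card : ℝ))

/-- The `q`-state Potts measure on `G` at inverse temperature `β` (as a probability vector). -/
noncomputable def potts (β : ℝ) (σ : V → Fin q) : ℝ :=
  pottsWeight G β σ / ∑ τ : V → Fin q, pottsWeight G β τ

/-- The probability of obtaining the colouring `τ` when every connected component of the graph
`(V, ω)` independently receives a uniform colour from `q` colours: each of the `q ^ k(ω)`
colourings that are constant on components is equally likely. Isolated vertices count as
components. -/
noncomputable def recolourProb (ω : Finset (Sym2 V)) (τ : V → Fin q) : ℝ :=
  open Classical in
  if ∀ u v : V, (fromEdgeSet (ω : Set (Sym2 V))).Reachable u v → τ u = τ v then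
    ((q : ℝ) ^ Nat.card (fromEdgeSet (ω : Set (Sym2 V))).ConnectedComponent)⁻¹
  else 0

/-- The transition matrix of the Swendsen-Wang dynamics: from `σ`, keep each monochromatic edge
independently with probability `p` to get the open edges `ω`, then recolour every component of
`(V, ω)` uniformly and independently. -/
noncomputable def kernel (q : ℕ) (p : ℝ) : Matrix (V → Fin q) (V → Fin q) ℝ :=
  fun σ τ => ∑ ω ∈ (monoEdges G σ).powerset,
    p ^ ω.card * (1 - p) ^ (monoEdges G σ \ ω).card * recolourProb ω τ

end Model

section Chain

variable {S : Type*} [Fintype S] [DecidableEq S]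

/-- The real eigenvalues of `P`, with multiplicity, in decreasing order `λ₁ ≥ λ₂ ≥ ⋯`. -/
noncomputable def eigenvalueList (P : Matrix S S ℝ) : List ℝ :=
  P.charpoly.roots.sort (· ≥ ·)

/-- The (absolute) spectral gap `1 - max {λ₂, |λ_{|S|}|}` of a reversible chain with transition
matrix `P` on a state space with at least two points. -/
noncomputable def spectralGap (P : Matrix S S ℝ) : ℝ :=
  1 - max ((eigenvalueList P).getD 1 0) |(eigenvalueList P).getLastD 0|

/-- The distance `‖μ - π‖_{L²(π)}`, that is the `L²(π)`-norm of `μ/π - 1`. -/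
noncomputable def l2Dist (μ π : S → ℝ) : ℝ :=
  Real.sqrt (∑ x, (μ x / π x - 1) ^ 2 * π x)

/-- The worst-case `L²(π)`-distance from `π` at time `t` of the chain with transition matrix `P`:
the row `(P ^ t) x₀` is the law at time `t` of the chain started from `x₀`. -/
noncomputable def worstL2Dist (P : Matrix S S ℝ) (π : S → ℝ) (t : ℕ) : ℝ :=
  ⨆ x₀ : S, l2Dist ((P ^ t) x₀) π

end Chain

end SwendsenWang

set_option linter.unusedSectionVars false

namespace SwendsenWang

open SimpleGraph

/-! ### Reversible chains: the spectral gap controls the decay in `L²`. -/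

section Chain

variable {S : Type*} [Fintype S] [DecidableEq S]

/-! Once the chain `P` is within `L²`-distance 2 of `π` at some time of order `log n`, the spectral
theorem shrinks the distance by the factor `1 - γ` at every later step (`worstL2Dist_le`). The
squared distance at time `t` is `P^(2t)(x,x)/π(x) - 1`, so it suffices that `P^(2t)(x,y) ≤ 5 π(y)`
for `t` near `2 log n` (`kernel_pow_le_five_mul_potts`). By stationarity this follows from
`P^(2t)(x,y) ≤ 5 P^(2t)(x',y)` for all `x'`.

For this comparison (`kernel_pow_le`), open every edge with probability `p` at each step, whatever
the colours, and ignore the open edges that are not monochromatic. Up to constants, `P^(k+1)(x,y)`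
becomes the sum over space-time configurations `η` of `(p/(1-p))^|η|` times a density `pathDens`
(`kernel_pow_eq`). Layer `k` is the first step of the chain and layer `0` the last. The density
factorizes over space-time clusters. A cluster missing layer `0` contributes 1, and one missing
layer `k` does not see `x`; only the clusters that cross from layer `0` to layer `k` carry the
dependence on `x` (`exists_split`).

The union `S` of the crossing clusters has density at most `4^|S|` (`pathDens_le_four_pow`). No `q`
appears, because the factor `q^(2|L i|)` can be charged to the least occupied layer once `q² ≤
2^(k+1)`; this is why `p₀` does not depend on `q`. Each crossing cluster has at least `k+1` edges,
so for small `p` a Peierls-type count (`sum_rooted_large_le`) bounds the sum over `S` by `(1 +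
O(2^(-(k+1))))^|E|`. This is bounded once `2^(k+1)` is at least of order `d n`. -/

lemma eigenvalueList_eq_ofFn {M : Matrix S S ℝ} (hM : M.IsHermitian) :
    eigenvalueList M = List.ofFn hM.eigenvalues₀ := by
  rw [← hM.sort_roots_charpoly_eq_eigenvalues₀, eigenvalueList]
  congr 1
  exact (Multiset.map_id' _).symm

/-- The quantity `max {λ₂, |λ_{|S|}|}` is `1 - spectralGap`. -/
lemma one_sub_spectralGap (P : Matrix S S ℝ) :
    1 - spectralGap P =
      max ((eigenvalueList P).getD 1 0) |(eigenvalueList P).getLastD 0| := by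
  simp [spectralGap]

lemma one_sub_spectralGap_nonneg (P : Matrix S S ℝ) : 0 ≤ 1 - spectralGap P := by
  rw [one_sub_spectralGap]
  exact le_max_of_le_right (abs_nonneg _)

lemma getD_one_eigenvalueList {M : Matrix S S ℝ} (hM : M.IsHermitian) (h : 1 < Fintype.card S) :
    (eigenvalueList M).getD 1 0 = hM.eigenvalues₀ ⟨1, h⟩ := by
  rw [eigenvalueList_eq_ofFn hM, List.getD_eq_getElem _ _ (by simpa using h)]
  simp

lemma getLastD_eigenvalueList {M : Matrix S S ℝ} (hM : M.IsHermitian) (h : 0 < Fintype.card S) :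
    (eigenvalueList M).getLastD 0 = hM.eigenvalues₀ ⟨Fintype.card S - 1, by omega⟩ := by
  have hne : List.ofFn hM.eigenvalues₀ ≠ [] := by
    intro h0
    have := congrArg List.length h0
    simp at this
    omega
  rw [eigenvalueList_eq_ofFn hM, List.getLastD_eq_getLast?, List.getLast?_eq_some_getLast hne,
    Option.getD_some, List.getLast_eq_getElem]
  simp

lemma abs_eigenvalues₀_le {M : Matrix S S ℝ} (hM : M.IsHermitian) (h : 1 < Fintype.card S)
    (j : Fin (Fintype.card S)) (hj : 1 ≤ j.val) :
    |hM.eigenvalues₀ j| ≤ 1 - spectralGap M := by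
  rw [one_sub_spectralGap, getD_one_eigenvalueList hM h, getLastD_eigenvalueList hM (by omega)]
  have h1 : hM.eigenvalues₀ j ≤ hM.eigenvalues₀ ⟨1, h⟩ :=
    hM.eigenvalues₀_antitone (show (⟨1, h⟩ : Fin _) ≤ j from hj)
  have h2 : hM.eigenvalues₀ ⟨Fintype.card S - 1, by omega⟩ ≤ hM.eigenvalues₀ j :=
    hM.eigenvalues₀_antitone (show j ≤ (⟨Fintype.card S - 1, by omega⟩ : Fin _) by
      rw [Fin.le_def]; simp only; omega)
  rcases le_total 0 (hM.eigenvalues₀ j) with h0 | h0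
  · rw [abs_of_nonneg h0]
    exact le_max_of_le_left h1
  · rw [abs_of_nonpos h0]
    refine le_max_of_le_right ?_
    rw [abs_of_nonpos (h2.trans h0)]
    linarith

/-- A symmetric matrix with spectrum in `[-1, 1]` contracts the orthogonal complement of a fixed
vector by the factor `1 - spectralGap`. -/
lemma sum_sq_mulVec_le {M : Matrix S S ℝ} (hM : M.IsHermitian) (h : 1 < Fintype.card S)
    (hle : ∀ i, hM.eigenvalues i ≤ 1) (v w : S → ℝ) (hv : v ≠ 0)
    (hMv : M.mulVec v = v) (hvw : ∑ x, v x * w x = 0) :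
    ∑ x, (M.mulVec w x) ^ 2 ≤ (1 - spectralGap M) ^ 2 * ∑ x, (w x) ^ 2 := by
  set ρ := 1 - spectralGap M
  have hρ : 0 ≤ ρ := one_sub_spectralGap_nonneg M
  set b := hM.eigenvectorBasis
  have hcoef : ∀ (u : S → ℝ) (i : S), inner ℝ (b i) (WithLp.toLp 2 (M.mulVec u)) =
      hM.eigenvalues i * inner ℝ (b i) (WithLp.toLp 2 u) := by
    intro u i
    have h1 := (Matrix.isSymmetric_toEuclideanLin_iff.mpr hM) (b i) (WithLp.toLp 2 u)
    have h2 : Matrix.toEuclideanLin M (b i) = hM.eigenvalues i • b i := by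
      have := hM.mulVec_eigenvectorBasis i
      ext x
      exact congrFun this x
    rw [h2, real_inner_smul_left] at h1
    rw [h1]
    rfl
  have hnorm : ∀ u : S → ℝ, ∑ x, (u x) ^ 2 = ∑ i, (inner ℝ (b i) (WithLp.toLp 2 u)) ^ 2 := by
    intro u
    have h1 := b.sum_sq_norm_inner_right (WithLp.toLp 2 u)
    rw [EuclideanSpace.norm_sq_eq] at h1
    simpa using h1.symm
  have horth : ∑ i, inner ℝ (WithLp.toLp 2 v) (b i) * inner ℝ (b i) (WithLp.toLp 2 w) = 0 := by
    rw [b.sum_inner_mul_inner, ← hvw]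
    simp [PiLp.inner_apply, mul_comm]
  rw [hnorm (M.mulVec w), hnorm w, Finset.mul_sum]
  refine Finset.sum_le_sum fun i _ => ?_
  rw [hcoef, mul_pow]
  let e := (Fintype.equivOfCardEq (Fintype.card_fin (Fintype.card S)) :
    Fin (Fintype.card S) ≃ S).symm
  have hother : ∀ k, 1 ≤ (e k).val → |hM.eigenvalues k| ≤ ρ := fun k hk =>
    abs_eigenvalues₀_le hM h (e k) hk
  -- Only the top index can exceed `ρ`. If `i` does, then `v` is a multiple of `b i`, so `w` has no
  -- component there.
  by_cases hi : |hM.eigenvalues i| ≤ ρ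
  · refine mul_le_mul_of_nonneg_right ?_ (sq_nonneg _)
    rw [← sq_abs]
    exact pow_le_pow_left₀ (abs_nonneg _) hi 2
  have hi0 : (e i).val = 0 := by
    by_contra h0
    exact hi (hother i (by omega))
  have hne : ∀ k, k ≠ i → |hM.eigenvalues k| ≤ ρ := by
    intro k hk
    refine hother k ?_
    by_contra h0
    exact hk (e.injective (Fin.ext (by omega)))
  have htop : ∀ k, hM.eigenvalues k ≤ hM.eigenvalues i := fun k =>
    hM.eigenvalues₀_antitone (show e i ≤ e k by rw [Fin.le_def]; omega)
  -- The top eigenvalue cannot lie below `-ρ`, since it dominates another one that is at least `-ρ`.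
  have hlt : ρ < hM.eigenvalues i := by
    obtain ⟨k, hk⟩ : ∃ k, k ≠ i := Fintype.exists_ne_of_one_lt_card h i
    have h1 := htop k
    have h2 := abs_le.mp (hne k hk)
    by_contra h3
    exact hi (abs_le.mpr ⟨by linarith, by linarith⟩)
  have hvk : ∀ k, k ≠ i → inner ℝ (b k) (WithLp.toLp 2 v) = 0 := by
    intro k hk
    have h1 := hcoef v k
    rw [hMv] at h1
    by_contra h2
    have h3 : hM.eigenvalues k = 1 := by
      field_simp at h1
      linarith
    have := (abs_le.mp (hne k hk)).2
    linarith [hle i]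
  have hvi : inner ℝ (b i) (WithLp.toLp 2 v) ≠ 0 := by
    intro h0
    apply hv
    have h1 := hnorm v
    have h2 : ∀ k, inner ℝ (b k) (WithLp.toLp 2 v) = 0 := fun k => by
      by_cases hk : k = i
      · rw [hk, h0]
      · exact hvk k hk
    simp only [h2] at h1
    simp only [ne_eq, OfNat.ofNat_ne_zero, not_false_eq_true, zero_pow, Finset.sum_const_zero] at h1
    rw [Finset.sum_eq_zero_iff_of_nonneg (fun _ _ => sq_nonneg _)] at h1
    ext x
    simpa using h1 x (Finset.mem_univ x)
  rw [Finset.sum_eq_single i (fun k _ hk => by rw [real_inner_comm, hvk k hk, zero_mul])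
    (by simp)] at horth
  rw [real_inner_comm] at horth
  rcases mul_eq_zero.mp horth with h1 | h1
  · exact absurd h1 hvi
  · simp [h1]

/-- The symmetrization `√π(x) P(x,y) / √π(y)` of a matrix. -/
noncomputable def symmetrization (P : Matrix S S ℝ) (π : S → ℝ) : Matrix S S ℝ :=
  fun x y => √(π x) * P x y * (√(π y))⁻¹

/-- Hypotheses for a reversible finite Markov chain with positive stationary law. -/
structure IsReversibleChain (P : Matrix S S ℝ) (π : S → ℝ) : Prop where
  nonneg : ∀ x y, 0 ≤ P x y
  row_sum : ∀ x, ∑ y, P x y = 1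
  pos : ∀ x, 0 < π x
  sum_eq_one : ∑ x, π x = 1
  reversible : ∀ x y, π x * P x y = π y * P y x

namespace IsReversibleChain

variable {P : Matrix S S ℝ} {π : S → ℝ}

lemma isHermitian_symmetrization (hP : IsReversibleChain P π) :
    (symmetrization P π).IsHermitian := by
  ext x y
  have hx := Real.sqrt_pos.mpr (hP.pos x)
  have hy := Real.sqrt_pos.mpr (hP.pos y)
  simp only [symmetrization, Matrix.conjTranspose_apply, star_trivial]
  have h := hP.reversible x y
  have hx2 := Real.mul_self_sqrt (hP.pos x).le
  have hy2 := Real.mul_self_sqrt (hP.pos y).le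
  field_simp
  rw [sq, sq, hx2, hy2]
  linarith

/-- The symmetrization is the conjugate of `P` by the diagonal matrix of `√π`, so the spectral gap
of `P` can be read off a symmetric matrix. -/
lemma charpoly_symmetrization (hP : IsReversibleChain P π) :
    (symmetrization P π).charpoly = P.charpoly := by
  have hu : Matrix.diagonal (fun x => √(π x)) * Matrix.diagonal (fun x => (√(π x))⁻¹) = 1 := by
    rw [Matrix.diagonal_mul_diagonal, ← Matrix.diagonal_one]
    congr 1
    ext x
    exact mul_inv_cancel₀ (Real.sqrt_pos.mpr (hP.pos x)).ne'
  have hu' : Matrix.diagonal (fun x => (√(π x))⁻¹) * Matrix.diagonal (fun x => √(π x)) = 1 := by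
    rw [Matrix.diagonal_mul_diagonal, ← Matrix.diagonal_one]
    congr 1
    ext x
    exact inv_mul_cancel₀ (Real.sqrt_pos.mpr (hP.pos x)).ne'
  have h : (Matrix.diagonal (fun x => √(π x)) * P *
      Matrix.diagonal (fun x => (√(π x))⁻¹)).charpoly = P.charpoly := by
    rw [Matrix.charpoly_mul_comm, ← mul_assoc, hu', one_mul]
  rw [← h]
  congr 1
  ext x y
  simp [symmetrization, Matrix.mul_diagonal, Matrix.diagonal_mul]

lemma spectralGap_symmetrization (hP : IsReversibleChain P π) :
    spectralGap (symmetrization P π) = spectralGap P := by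
  simp only [spectralGap, eigenvalueList, hP.charpoly_symmetrization]

lemma symmetrization_mulVec (hP : IsReversibleChain P π) (f : S → ℝ) (x : S) :
    (symmetrization P π).mulVec (fun y => √(π y) * f y) x = √(π x) * P.mulVec f x := by
  simp only [Matrix.mulVec, dotProduct, symmetrization, Finset.mul_sum]
  refine Finset.sum_congr rfl fun y _ => ?_
  have hy := Real.sqrt_pos.mpr (hP.pos y)
  field_simp

/-- Maximum principle: evaluate the eigenvalue equation where `|f|` is largest. -/
lemma abs_eigenvalue_le_one (hP : IsReversibleChain P π) {f : S → ℝ} (hf : f ≠ 0) {c : ℝ}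
    (h : P.mulVec f = c • f) : |c| ≤ 1 := by
  obtain ⟨z, hz⟩ := Function.ne_iff.mp hf
  obtain ⟨x, -, hx⟩ := Finset.exists_max_image Finset.univ (fun y => |f y|) ⟨z, Finset.mem_univ z⟩
  have hpos : 0 < |f x| := (abs_pos.mpr hz).trans_le (hx z (Finset.mem_univ z))
  have h1 : c * f x = ∑ y, P x y * f y := (congrFun h x).symm
  have h2 : |c| * |f x| ≤ 1 * |f x| := by
    rw [← abs_mul, h1, ← hP.row_sum x, Finset.sum_mul]
    refine (Finset.abs_sum_le_sum_abs _ _).trans (Finset.sum_le_sum fun y _ => ?_)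
    rw [abs_mul, abs_of_nonneg (hP.nonneg x y)]
    exact mul_le_mul_of_nonneg_left (hx y (Finset.mem_univ y)) (hP.nonneg x y)
  exact le_of_mul_le_mul_right h2 hpos

lemma abs_eigenvalues_symmetrization_le (hP : IsReversibleChain P π) (i : S) :
    |hP.isHermitian_symmetrization.eigenvalues i| ≤ 1 := by
  set hM := hP.isHermitian_symmetrization
  have h1 := hM.mulVec_eigenvectorBasis i
  set u : S → ℝ := ⇑(hM.eigenvectorBasis i)
  have hu : u = fun y => √(π y) * (u y / √(π y)) := by
    ext y
    have hy := Real.sqrt_pos.mpr (hP.pos y)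
    field_simp
  refine hP.abs_eigenvalue_le_one (f := fun y => u y / √(π y)) ?_ ?_
  · intro h0
    have hu0 : u = 0 := by
      rw [hu]
      ext y
      have := congrFun h0 y
      simp only [Pi.zero_apply] at this ⊢
      rw [this, mul_zero]
    have h3 := hM.eigenvectorBasis.orthonormal.1 i
    have h4 : hM.eigenvectorBasis i = 0 := by
      ext y
      exact congrFun hu0 y
    rw [h4] at h3
    simp at h3
  · ext x
    have h2 := congrFun h1 x
    rw [hu, hP.symmetrization_mulVec, ← hu] at h2
    have hx := Real.sqrt_pos.mpr (hP.pos x)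
    simp only [Pi.smul_apply, smul_eq_mul] at h2 ⊢
    field_simp
    linarith

lemma one_sub_spectralGap_le_one (hP : IsReversibleChain P π) (h : 1 < Fintype.card S) :
    1 - spectralGap P ≤ 1 := by
  have hM := hP.isHermitian_symmetrization
  have hall : ∀ j, |hM.eigenvalues₀ j| ≤ 1 := by
    intro j
    have := hP.abs_eigenvalues_symmetrization_le
      ((Fintype.equivOfCardEq (Fintype.card_fin _)) j)
    simpa [Matrix.IsHermitian.eigenvalues] using this
  rw [← hP.spectralGap_symmetrization, one_sub_spectralGap, getD_one_eigenvalueList hM h,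
    getLastD_eigenvalueList hM (by omega)]
  exact max_le ((le_abs_self _).trans (hall _)) (hall _)

lemma pow_reversible (hP : IsReversibleChain P π) (t : ℕ) (x y : S) :
    π x * (P ^ t) x y = π y * (P ^ t) y x := by
  induction t generalizing x y with
  | zero =>
    by_cases h : x = y
    · rw [h]
    · simp [h, Ne.symm h]
  | succ t ih =>
    rw [pow_succ, Matrix.mul_apply, ← pow_succ, pow_succ', Matrix.mul_apply, Finset.mul_sum,
      Finset.mul_sum]
    refine Finset.sum_congr rfl fun z _ => ?_
    rw [← mul_assoc, ih, mul_comm (π z), mul_assoc, hP.reversible z y]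
    ring

lemma pow_row_sum (hP : IsReversibleChain P π) (t : ℕ) (x : S) : ∑ y, (P ^ t) x y = 1 := by
  induction t generalizing x with
  | zero => simp [Matrix.one_apply]
  | succ t ih =>
    simp only [pow_succ, Matrix.mul_apply]
    rw [Finset.sum_comm]
    simp only [← Finset.mul_sum, hP.row_sum, mul_one, ih]

lemma stationary_pow (hP : IsReversibleChain P π) (t : ℕ) (y : S) :
    ∑ x, π x * (P ^ t) x y = π y := by
  simp only [hP.pow_reversible t _ y, ← Finset.mul_sum, hP.pow_row_sum, mul_one]

/-- The squared `L²(π)`-distance at time `t` is `P^{2t}(x,x)/π(x) - 1`. -/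
lemma sum_sq_eq (hP : IsReversibleChain P π) (t : ℕ) (x : S) :
    ∑ y, ((P ^ t) x y / π y - 1) ^ 2 * π y = (P ^ (2 * t)) x x / π x - 1 := by
  have h1 : ∀ y, ((P ^ t) x y / π y - 1) ^ 2 * π y =
      (P ^ t) x y * (P ^ t) y x / π x - 2 * (P ^ t) x y + π y := by
    intro y
    have hx := hP.pos x
    have hy := hP.pos y
    have h2 := hP.pow_reversible t x y
    have h3 : (P ^ t) y x / π x = (P ^ t) x y / π y := by
      field_simp
      linarith
    rw [mul_div_assoc, h3]
    field_simp
    ring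
  simp only [h1, Finset.sum_add_distrib, Finset.sum_sub_distrib, ← Finset.mul_sum,
    ← Finset.sum_div, hP.pow_row_sum, hP.sum_eq_one]
  rw [two_mul t, pow_add, Matrix.mul_apply]
  ring

/-- By reversibility, `P^t(x,·)/π - 1` evolves by applying `P`. Multiplied by `√π`, it is orthogonal
to `√π`, which the symmetrization fixes, so `sum_sq_mulVec_le` applies. -/
lemma l2Dist_succ_le (hP : IsReversibleChain P π) (h : 1 < Fintype.card S) (t : ℕ) (x : S) :
    l2Dist ((P ^ (t + 1)) x) π ≤ (1 - spectralGap P) * l2Dist ((P ^ t) x) π := by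
  set f : ℕ → S → ℝ := fun t y => (P ^ t) x y / π y - 1
  have hsq : ∀ t, ∑ y, (f t y) ^ 2 * π y = ∑ y, (√(π y) * f t y) ^ 2 := fun t =>
    Finset.sum_congr rfl fun y _ => by
      rw [mul_pow, Real.sq_sqrt (hP.pos y).le, mul_comm]
  have hstep : ∀ y, f (t + 1) y = P.mulVec (f t) y := by
    intro y
    have hy := hP.pos y
    simp only [f, Matrix.mulVec, dotProduct, mul_sub, mul_one, Finset.sum_sub_distrib, hP.row_sum,
      pow_succ, Matrix.mul_apply, Finset.sum_div]
    congr 1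
    refine Finset.sum_congr rfl fun z _ => ?_
    have hz := hP.pos z
    have := hP.reversible z y
    field_simp
    linear_combination (P ^ t) x z * this
  have hv : (fun y => √(π y) * (1 : S → ℝ) y) ≠ 0 := fun h0 => by
    have := congrFun h0 x
    simp at this
    exact absurd this (Real.sqrt_pos.mpr (hP.pos x)).ne'
  have key := sum_sq_mulVec_le hP.isHermitian_symmetrization h
    (fun i => (le_abs_self _).trans (hP.abs_eigenvalues_symmetrization_le i))
    (fun y => √(π y) * (1 : S → ℝ) y) (fun y => √(π y) * f t y) hv ?_ ?_
  · simp only [hP.symmetrization_mulVec, hP.spectralGap_symmetrization] at key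
    simp only [l2Dist]
    change √(∑ y, (f (t + 1) y) ^ 2 * π y) ≤ _ * √(∑ y, (f t y) ^ 2 * π y)
    rw [hsq, hsq]
    simp only [hstep]
    refine (Real.sqrt_le_sqrt key).trans ?_
    rw [Real.sqrt_mul (sq_nonneg _), Real.sqrt_sq (one_sub_spectralGap_nonneg P)]
  · ext y
    rw [hP.symmetrization_mulVec]
    simp [Matrix.mulVec, dotProduct, hP.row_sum]
  · have h1 : ∀ y, √(π y) * (1 : S → ℝ) y * (√(π y) * f t y) = (P ^ t) x y - π y := by
      intro y
      have hy := hP.pos y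
      have := Real.mul_self_sqrt hy.le
      simp only [Pi.one_apply, mul_one, f]
      rw [← mul_assoc, this]
      field_simp
    simp only [h1, Finset.sum_sub_distrib, hP.pow_row_sum, hP.sum_eq_one, sub_self]

lemma l2Dist_add_le (hP : IsReversibleChain P π) (h : 1 < Fintype.card S) (s t : ℕ) (x : S) :
    l2Dist ((P ^ (s + t)) x) π ≤ (1 - spectralGap P) ^ t * l2Dist ((P ^ s) x) π := by
  induction t with
  | zero => simp
  | succ t ih =>
    rw [← add_assoc, pow_succ' (1 - spectralGap P), mul_assoc]
    exact (hP.l2Dist_succ_le h _ x).trans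
      (mul_le_mul_of_nonneg_left ih (one_sub_spectralGap_nonneg P))

/-- The constant is `5 = 1 + 2²`, through `sum_sq_eq`. -/
lemma l2Dist_le_two (hP : IsReversibleChain P π) (t : ℕ) (x : S)
    (h : (P ^ (2 * t)) x x ≤ 5 * π x) : l2Dist ((P ^ t) x) π ≤ 2 := by
  rw [l2Dist, hP.sum_sq_eq, Real.sqrt_le_left (by norm_num)]
  have := (div_le_iff₀ (hP.pos x)).mpr h
  linarith

/-- If the chain is within `L²`-distance `2` of equilibrium at time `s ≤ a`, then from time `a` on
the distance decays exponentially at the rate given by the spectral gap. -/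
lemma worstL2Dist_le (hP : IsReversibleChain P π) (h : 1 < Fintype.card S) (s t : ℕ) (a : ℝ)
    (hs : (s : ℝ) ≤ a) (hat : a ≤ t) (h2 : ∀ x, l2Dist ((P ^ s) x) π ≤ 2) :
    worstL2Dist P π t ≤ 2 * Real.exp (-Real.log (1 / (1 - spectralGap P)) * (t - a)) := by
  have hρ0 := one_sub_spectralGap_nonneg P
  have hρ1 := hP.one_sub_spectralGap_le_one h
  have hst : s ≤ t := by exact_mod_cast hs.trans hat
  have hexp : (1 - spectralGap P) ^ (t - s) ≤
      Real.exp (-Real.log (1 / (1 - spectralGap P)) * (t - a)) := by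
    rw [one_div, Real.log_inv, neg_neg]
    -- If `1 - γ = 0`, the convention `log 0 = 0` makes the exponential equal to 1.
    rcases hρ0.eq_or_lt with h0 | h0
    · rw [← h0]
      simp only [Real.log_zero, zero_mul, Real.exp_zero]
      exact pow_le_one₀ le_rfl zero_le_one
    · rw [← Real.rpow_def_of_pos h0, ← Real.rpow_natCast]
      refine Real.rpow_le_rpow_of_exponent_ge h0 hρ1 ?_
      rw [Nat.cast_sub hst]
      linarith
  have : Nonempty S := Fintype.card_pos_iff.mp (by omega)
  refine ciSup_le fun x => ?_
  obtain ⟨u, rfl⟩ := Nat.exists_eq_add_of_le hst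
  refine (hP.l2Dist_add_le h s u x).trans ?_
  rw [Nat.add_sub_cancel_left] at hexp
  rw [mul_comm]
  exact mul_le_mul (h2 x) hexp (pow_nonneg hρ0 _) zero_le_two

end IsReversibleChain

end Chain

/-! ### Counting rooted sets in graphs of bounded degree. -/

section Rooted

variable {α : Type*} [DecidableEq α] (nb : α → Finset α)

/-- `U` is closed under the neighbourhoods `nb` inside `S`. -/
def ClosedIn (S U : Finset α) : Prop :=
  ∀ e ∈ U, ∀ f ∈ S, f ∈ nb e → f ∈ U

/-- `S` is rooted at `R`: every nonempty part of `S` closed under adjacency in `S` (that is, every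
union of connected components of `S`) meets `R`. -/
def Rooted (R S : Finset α) : Prop :=
  ∀ U ⊆ S, Disjoint U R → ClosedIn nb S U → U = ∅

variable {nb}

lemma Rooted.eq_empty {R S : Finset α} (h : Rooted nb R S) (hd : Disjoint S R) : S = ∅ :=
  h S subset_rfl hd fun _ _ _ hf _ => hf

lemma Rooted.erase_root {R S : Finset α} {r : α} (h : Rooted nb R S) (hr : r ∉ S) :
    Rooted nb (R.erase r) S := by
  intro U hU hd hc
  refine h U hU ?_ hc
  rw [Finset.disjoint_left] at hd ⊢
  exact fun e he heR => hd he (Finset.mem_erase.mpr ⟨fun h0 => hr (h0 ▸ hU he), heR⟩)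

/-- A closed part of `S \ {r}` that avoids `nb r` is not adjacent to `r`, so it is still closed in
`S`. -/
lemma Rooted.erase_both {R S : Finset α} {r : α} (hsymm : ∀ e f, f ∈ nb e → e ∈ nb f)
    (h : Rooted nb R S) : Rooted nb (R.erase r ∪ nb r) (S.erase r) := by
  intro U hU hd hc
  rw [Finset.disjoint_left] at hd
  have hrU : r ∉ U := fun h0 => Finset.notMem_erase r S (hU h0)
  refine h U (hU.trans (Finset.erase_subset _ _)) ?_ ?_
  · rw [Finset.disjoint_left]
    exact fun e he heR => hd he (Finset.mem_union_left _
      (Finset.mem_erase.mpr ⟨fun h0 => hrU (h0 ▸ he), heR⟩))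
  · intro e he f hf hfe
    by_cases hfr : f = r
    · subst hfr
      exact absurd (Finset.mem_union_right _ (hsymm e f hfe)) (hd he)
    · exact hc e he f (Finset.mem_erase.mpr ⟨hfr, hf⟩) hfe

open Classical in
/-- Peeling bound for the generating function of rooted sets in a graph of degree at most `Δ`. -/
lemma sum_rooted_le (hsymm : ∀ e f, f ∈ nb e → e ∈ nb f) {Δ : ℕ} (hΔ : ∀ e, (nb e).card ≤ Δ)
    {a c : ℝ} (ha : 0 ≤ a) (hc : 0 ≤ c) (hac : a * (1 + c) ^ Δ ≤ c) (X R : Finset α) :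
    ∑ S ∈ X.powerset with Rooted nb R S, a ^ S.card ≤ (1 + c) ^ R.card := by
  have h1c : 1 ≤ 1 + c := by linarith
  induction hX : X.card generalizing X R with
  | zero =>
    rw [Finset.card_eq_zero] at hX
    subst hX
    rw [Finset.sum_filter]
    simp only [Finset.powerset_empty, Finset.sum_singleton, Finset.card_empty, pow_zero]
    split_ifs
    · exact one_le_pow₀ h1c
    · exact (zero_le_one).trans (one_le_pow₀ h1c)
  | succ m ih =>
    by_cases hXR : Disjoint X R
    · refine le_trans ?_ (one_le_pow₀ h1c : 1 ≤ (1 + c) ^ R.card)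
      calc ∑ S ∈ X.powerset with Rooted nb R S, a ^ S.card
          ≤ ∑ S ∈ ({∅} : Finset (Finset α)), a ^ S.card := by
            refine Finset.sum_le_sum_of_subset_of_nonneg ?_ fun _ _ _ => pow_nonneg ha _
            intro S hS
            rw [Finset.mem_filter, Finset.mem_powerset] at hS
            rw [Finset.mem_singleton]
            exact hS.2.eq_empty (hXR.mono_left hS.1)
        _ = 1 := by simp
    · rw [Finset.not_disjoint_iff] at hXR
      obtain ⟨r, hrX, hrR⟩ := hXR
      have hcard : (X.erase r).card = m := by rw [Finset.card_erase_of_mem hrX, hX]; rfl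
      have hRcard : R.card = (R.erase r).card + 1 := (Finset.card_erase_add_one hrR).symm
      have hX' : X = insert r (X.erase r) := (Finset.insert_erase hrX).symm
      -- Explore the root `r`: if it is absent, drop it; if present, pay `a` and let its neighbours
      -- become roots. The new roots cost at most `(1 + c)^Δ`, which `hac` absorbs.
      have hstep : ∑ S ∈ X.powerset with Rooted nb R S, a ^ S.card ≤
          (∑ S ∈ (X.erase r).powerset with Rooted nb (R.erase r) S, a ^ S.card) +
          a * ∑ S ∈ (X.erase r).powerset with Rooted nb (R.erase r ∪ nb r) S, a ^ S.card := by
        rw [Finset.sum_filter, hX', Finset.sum_powerset_insert (Finset.notMem_erase r X),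
          ← hX', Finset.sum_filter, Finset.sum_filter, Finset.mul_sum]
        refine add_le_add (Finset.sum_le_sum fun S hS => ?_) (Finset.sum_le_sum fun S hS => ?_)
        · have hrS : r ∉ S := fun h0 =>
            Finset.notMem_erase r X (Finset.mem_powerset.mp hS h0)
          split_ifs with h1 h2
          · exact le_rfl
          · exact absurd (h1.erase_root hrS) h2
          · exact pow_nonneg ha _
          · exact le_rfl
        · have hrS : r ∉ S := fun h0 =>
            Finset.notMem_erase r X (Finset.mem_powerset.mp hS h0)
          split_ifs with h1 h2
          · rw [Finset.card_insert_of_notMem hrS, pow_succ']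
          · have h3 := h1.erase_both (r := r) hsymm
            rw [Finset.erase_insert hrS] at h3
            exact absurd h3 h2
          · exact mul_nonneg ha (pow_nonneg ha _)
          · simp
      refine hstep.trans ?_
      have h1 := ih (X.erase r) (R.erase r) hcard
      have h2 := ih (X.erase r) (R.erase r ∪ nb r) hcard
      have h3 : (1 + c) ^ (R.erase r ∪ nb r).card ≤ (1 + c) ^ (R.erase r).card * (1 + c) ^ Δ := by
        rw [← pow_add]
        exact pow_le_pow_right₀ h1c ((Finset.card_union_le _ _).trans
          (Nat.add_le_add_left (hΔ r) _))
      have h4 : a * ∑ S ∈ (X.erase r).powerset with Rooted nb (R.erase r ∪ nb r) S, a ^ S.card ≤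
          (1 + c) ^ (R.erase r).card * c := by
        refine (mul_le_mul_of_nonneg_left (h2.trans h3) ha).trans ?_
        rw [mul_left_comm]
        exact mul_le_mul_of_nonneg_left hac (pow_nonneg (by linarith) _)
      rw [hRcard, pow_succ, mul_add, mul_one]
      exact add_le_add h1 h4

open Classical in
/-- Sets rooted at a subset `R` of `B` that have at least `s |R|` elements. -/
lemma sum_rooted_large_le (hsymm : ∀ e f, f ∈ nb e → e ∈ nb f) {Δ : ℕ}
    (hΔ : ∀ e, (nb e).card ≤ Δ) {a c θ : ℝ} (ha : 0 ≤ a) (hc : 0 ≤ c) (hθ : 0 < θ) (hθ1 : θ ≤ 1)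
    (hac : a / θ * (1 + c) ^ Δ ≤ c) (X B : Finset α) (s : ℕ) :
    ∑ S ∈ X.powerset with ∃ R ⊆ B, Rooted nb R S ∧ s * R.card ≤ S.card, a ^ S.card ≤
      (1 + θ ^ s * (1 + c)) ^ B.card := by
  have haθ : 0 ≤ a / θ := div_nonneg ha hθ.le
  -- Exponential tilt: `|S| ≥ s|R|` and `θ ≤ 1` give `a^|S| ≤ θ^(s|R|) (a/θ)^|S|`. A union bound
  -- over `R` then leaves a binomial sum.
  calc ∑ S ∈ X.powerset with ∃ R ⊆ B, Rooted nb R S ∧ s * R.card ≤ S.card, a ^ S.card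
      ≤ ∑ S ∈ X.powerset, ∑ R ∈ B.powerset,
          if Rooted nb R S then θ ^ (s * R.card) * (a / θ) ^ S.card else 0 := by
        rw [Finset.sum_filter]
        refine Finset.sum_le_sum fun S _ => ?_
        have hnn : ∀ R ∈ B.powerset,
            0 ≤ if Rooted nb R S then θ ^ (s * R.card) * (a / θ) ^ S.card else 0 := by
          intro R _
          split_ifs
          · positivity
          · exact le_rfl
        split_ifs with h
        · obtain ⟨R, hRB, hR, hcard⟩ := h
          refine le_trans ?_ (Finset.single_le_sum hnn (Finset.mem_powerset.mpr hRB))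
          rw [if_pos hR, div_pow, mul_div_assoc', le_div_iff₀ (pow_pos hθ _), mul_comm]
          exact mul_le_mul_of_nonneg_right (pow_le_pow_of_le_one hθ.le hθ1 hcard)
            (pow_nonneg ha _)
        · exact Finset.sum_nonneg hnn
    _ = ∑ R ∈ B.powerset, θ ^ (s * R.card) *
          ∑ S ∈ X.powerset with Rooted nb R S, (a / θ) ^ S.card := by
        rw [Finset.sum_comm]
        refine Finset.sum_congr rfl fun R _ => ?_
        rw [Finset.sum_filter, Finset.mul_sum]
        refine Finset.sum_congr rfl fun S _ => ?_
        split_ifs <;> simp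
    _ ≤ ∑ R ∈ B.powerset, (θ ^ s * (1 + c)) ^ R.card := by
        refine Finset.sum_le_sum fun R _ => ?_
        rw [mul_pow, ← pow_mul]
        exact mul_le_mul_of_nonneg_left (sum_rooted_le hsymm hΔ haθ hc hac X R) (by positivity)
    _ = (1 + θ ^ s * (1 + c)) ^ B.card := by
        have := Finset.sum_pow_mul_eq_add_pow (θ ^ s * (1 + c)) 1 B
        simp only [one_pow, mul_one] at this
        rw [this, add_comm]

end Rooted

/-! ### Clusters that cross all layers. -/

section Crossing

variable {α : Type*} (nb : α → Finset α)

/-- The graph on `η` whose adjacency is given by the neighbourhoods `nb`. -/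
def clusterGraph (η : Finset α) : SimpleGraph α :=
  SimpleGraph.fromRel fun e f => e ∈ η ∧ f ∈ η ∧ f ∈ nb e

/-- The cluster of `e` in `η`. -/
def cluster (η : Finset α) (e : α) : (clusterGraph nb η).ConnectedComponent :=
  (clusterGraph nb η).connectedComponentMk e

variable {nb}

lemma cluster_eq_of_mem {η : Finset α} {e f : α} (he : e ∈ η) (hf : f ∈ η) (h : f ∈ nb e) :
    cluster nb η e = cluster nb η f := by
  by_cases hef : e = f
  · rw [hef]
  · exact ConnectedComponent.sound (Adj.reachable ⟨hef, Or.inl ⟨he, hf, h⟩⟩)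

/-- Induction along a cluster. -/
lemma cluster_induction (hsymm : ∀ e f, f ∈ nb e → e ∈ nb f) {η : Finset α} {p : α → Prop} {e : α}
    (h0 : p e)
    (hstep : ∀ f g, cluster nb η f = cluster nb η e → p f → f ∈ η → g ∈ η → g ∈ nb f → p g)
    {f : α} (hf : cluster nb η f = cluster nb η e) : p f := by
  have hr : (clusterGraph nb η).Reachable e f := (ConnectedComponent.exact hf).symm
  have hr' := (reachable_iff_reflTransGen e f).mp hr
  clear hf hr
  suffices h : p f ∧ cluster nb η f = cluster nb η e from h.1
  induction hr' with
  | refl => exact ⟨h0, rfl⟩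
  | @tail f g _ hadj ih =>
    obtain ⟨hp, hc⟩ := ih
    obtain ⟨hne, hfg⟩ := hadj
    have hmem : f ∈ η ∧ g ∈ η ∧ g ∈ nb f := by
      rcases hfg with h | h
      · exact h
      · exact ⟨h.2.1, h.1, hsymm _ _ h.2.2⟩
    exact ⟨hstep f g hc hp hmem.1 hmem.2.1 hmem.2.2,
      (cluster_eq_of_mem hmem.1 hmem.2.1 hmem.2.2).symm.trans hc⟩

variable [DecidableEq α]

/-- Split a layered set `η` into the union `S` of the clusters that cross from layer `0` to layer
`k`, the union `A` of the other clusters that meet layer `k`, and the rest. -/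
lemma exists_crossing_decomposition (hsymm : ∀ e f, f ∈ nb e → e ∈ nb f) (l : α → ℕ)
    (hl : ∀ e f, f ∈ nb e → l f ≤ l e + 1) (k : ℕ) (η : Finset α) :
    ∃ S ⊆ η, ∃ A ⊆ η \ S,
      (∀ e ∈ S, ∀ f ∈ η \ S, f ∉ nb e) ∧
      (∀ e ∈ A, ∀ f ∈ (η \ S) \ A, f ∉ nb e) ∧
      (∀ e ∈ A, l e ≠ 0) ∧ (∀ e ∈ (η \ S) \ A, l e ≠ k) ∧
      ∃ R ⊆ η.filter (fun e => l e = 0), Rooted nb R S ∧ (k + 1) * R.card ≤ S.card := by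
  classical
  let lo : α → Prop := fun e => ∃ f ∈ η, l f = 0 ∧ cluster nb η f = cluster nb η e
  let hi : α → Prop := fun e => ∃ f ∈ η, l f = k ∧ cluster nb η f = cluster nb η e
  have hlo : ∀ e f, cluster nb η e = cluster nb η f → lo e → lo f :=
    fun e f h ⟨g, hg, h1, h2⟩ => ⟨g, hg, h1, h2.trans h⟩
  have hhi : ∀ e f, cluster nb η e = cluster nb η f → hi e → hi f :=
    fun e f h ⟨g, hg, h1, h2⟩ => ⟨g, hg, h1, h2.trans h⟩
  let S := η.filter fun e => lo e ∧ hi e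
  let A := (η \ S).filter hi
  have hSmem : ∀ e, e ∈ S ↔ e ∈ η ∧ lo e ∧ hi e := fun e => Finset.mem_filter
  have hAmem : ∀ e, e ∈ A ↔ e ∈ η \ S ∧ hi e := fun e => Finset.mem_filter
  let B := S.filter fun e => l e = 0
  -- `R` picks exactly one layer-`0` element from each crossing cluster, so that `|R|` counts these
  -- clusters.
  obtain ⟨R, hRB, hRcard, hRimg⟩ : ∃ R ⊆ B, R.card = (B.image (cluster nb η)).card ∧
      R.image (cluster nb η) = B.image (cluster nb η) := by
    obtain ⟨R, hRB, hinj, himg⟩ := Finset.exists_subset_injOn_image_eq_of_surjOn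
      (f := cluster nb η) (B : Set α) (B.image (cluster nb η)) (by
        rw [Finset.coe_image]
        exact Set.surjOn_image _ _)
    exact ⟨R, hRB, by rw [← himg, Finset.card_image_of_injOn hinj], himg⟩
  refine ⟨S, Finset.filter_subset _ _, A, Finset.filter_subset _ _, ?_, ?_, ?_, ?_, R, ?_, ?_, ?_⟩
  · intro e he f hf hadj
    rw [Finset.mem_sdiff] at hf
    rw [hSmem] at he
    have hc := cluster_eq_of_mem he.1 hf.1 hadj
    exact hf.2 ((hSmem f).mpr ⟨hf.1, hlo e f hc he.2.1, hhi e f hc he.2.2⟩)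
  · intro e he f hf hadj
    rw [Finset.mem_sdiff] at hf
    rw [hAmem] at he
    have hc := cluster_eq_of_mem (Finset.mem_sdiff.mp he.1).1 (Finset.mem_sdiff.mp hf.1).1 hadj
    exact hf.2 ((hAmem f).mpr ⟨hf.1, hhi e f hc he.2⟩)
  · intro e he h0
    rw [hAmem, Finset.mem_sdiff] at he
    exact he.1.2 ((hSmem e).mpr ⟨he.1.1, ⟨e, he.1.1, h0, rfl⟩, he.2⟩)
  · intro e he hk
    rw [Finset.mem_sdiff] at he
    exact he.2 ((hAmem e).mpr ⟨he.1, ⟨e, (Finset.mem_sdiff.mp he.1).1, hk, rfl⟩⟩)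
  · exact hRB.trans (Finset.filter_subset_filter _ (Finset.filter_subset _ _))
  -- A closed set containing `e` contains the whole cluster of `e`, hence its representative in `R`.
  · intro U hUS hd hc
    by_contra hne
    obtain ⟨e, he⟩ := Finset.nonempty_iff_ne_empty.mpr hne
    have heS := (hSmem e).mp (hUS he)
    obtain ⟨b, hb, hb0, hbe⟩ := heS.2.1
    have hbB : b ∈ B := Finset.mem_filter.mpr
      ⟨(hSmem b).mpr ⟨hb, hlo _ _ hbe.symm heS.2.1, hhi _ _ hbe.symm heS.2.2⟩, hb0⟩
    have hbR := Finset.mem_image_of_mem (cluster nb η) hbB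
    rw [← hRimg, Finset.mem_image] at hbR
    obtain ⟨r, hr, hrb⟩ := hbR
    refine Finset.disjoint_left.mp hd (?_ : r ∈ U) hr
    refine cluster_induction (p := fun f => f ∈ U) hsymm he ?_ (hrb.trans hbe)
    intro f g hf hfU hfη hgη hadj
    have hce := (cluster_eq_of_mem hfη hgη hadj).symm.trans hf
    exact hc f hfU g ((hSmem g).mpr ⟨hgη, hlo _ _ hce.symm heS.2.1, hhi _ _ hce.symm heS.2.2⟩) hadj
  -- Discrete intermediate values: a step raises the layer by at most one, so a crossing cluster
  -- meets each of the `k + 1` layers. The pairs (cluster, layer) are therefore all realized in `S`.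
  · have hsub : (B.image (cluster nb η)) ×ˢ Finset.range (k + 1) ⊆
        S.image fun e => (cluster nb η e, l e) := by
      rintro ⟨c, i⟩ hci
      rw [Finset.mem_product, Finset.mem_image, Finset.mem_range] at hci
      obtain ⟨⟨b, hbB, rfl⟩, hi'⟩ := hci
      obtain ⟨hbS, hb0⟩ := Finset.mem_filter.mp hbB
      have hbS' := (hSmem b).mp hbS
      obtain ⟨f, hf, hfk, hfb⟩ := hbS'.2.2
      have key : ∀ i ≤ l f, ∃ e ∈ η, cluster nb η e = cluster nb η b ∧ l e = i := by
        refine cluster_induction (nb := nb) (η := η) (e := b)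
          (p := fun f => ∀ i ≤ l f, ∃ e ∈ η, cluster nb η e = cluster nb η b ∧ l e = i)
          hsymm ?_ ?_ hfb
        · intro i hi0
          exact ⟨b, hbS'.1, rfl, by omega⟩
        · intro g h hg hp hgη hhη hadj i hih
          by_cases hig : i ≤ l g
          · exact hp i hig
          · have := hl g h hadj
            exact ⟨h, hhη, (cluster_eq_of_mem hgη hhη hadj).symm.trans hg, by omega⟩
      obtain ⟨e, heη, heb, hei⟩ := key i (by omega)
      refine Finset.mem_image.mpr ⟨e, (hSmem e).mpr
        ⟨heη, hlo _ _ heb.symm hbS'.2.1, hhi _ _ heb.symm hbS'.2.2⟩, ?_⟩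
      rw [heb, hei]
    have h1 := (Finset.card_le_card hsub).trans Finset.card_image_le
    rw [Finset.card_product, Finset.card_range] at h1
    rw [hRcard, mul_comm]
    exact h1

end Crossing

/-! ### Uniform colourings, independence and conditional densities. -/

section Average

variable {V : Type*} [Fintype V] [DecidableEq V] {q : ℕ}

/-- The average over a uniformly random colouring. -/
noncomputable def avg (f : (V → Fin q) → ℝ) : ℝ :=
  (∑ τ, f τ) / (q : ℝ) ^ Fintype.card V

lemma pow_card_pos (hq : 0 < q) : (0 : ℝ) < (q : ℝ) ^ Fintype.card V := by positivity

lemma avg_nonneg {f : (V → Fin q) → ℝ} (hf : ∀ τ, 0 ≤ f τ) : 0 ≤ avg f :=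
  div_nonneg (Finset.sum_nonneg fun τ _ => hf τ) (by positivity)

lemma avg_mono {f g : (V → Fin q) → ℝ} (h : ∀ τ, f τ ≤ g τ) : avg f ≤ avg g :=
  div_le_div_of_nonneg_right (Finset.sum_le_sum fun τ _ => h τ) (by positivity)

lemma avg_const_mul (c : ℝ) (f : (V → Fin q) → ℝ) : avg (fun τ => c * f τ) = c * avg f := by
  rw [avg, avg, ← Finset.mul_sum, mul_div_assoc]

lemma avg_sum {ι : Type*} (s : Finset ι) (f : ι → (V → Fin q) → ℝ) :
    avg (fun τ => ∑ i ∈ s, f i τ) = ∑ i ∈ s, avg (f i) := by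
  simp only [avg]
  rw [Finset.sum_comm, Finset.sum_div]

lemma avg_one (hq : 0 < q) : avg (fun _ : V → Fin q => 1) = 1 := by
  have := pow_card_pos (V := V) hq
  rw [avg, div_eq_one_iff_eq this.ne']
  simp

open Classical in
/-- Functions of disjoint sets of coordinates are independent under a uniform colouring. -/
lemma avg_mul_of_dependsOn (hq : 0 < q) {f g : (V → Fin q) → ℝ} {A B : Set V}
    (hf : DependsOn f A) (hg : DependsOn g B) (hAB : Disjoint A B) :
    avg (fun τ => f τ * g τ) = avg f * avg g := by
  let mix : (V → Fin q) → (V → Fin q) → V → Fin q := fun τ τ' v => if v ∈ A then τ v else τ' v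
  -- Exchanging the coordinates outside `A` between two independent copies turns `f τ * g τ'` into
  -- `f τ * g τ`.
  let φ : (V → Fin q) × (V → Fin q) ≃ (V → Fin q) × (V → Fin q) :=
    { toFun := fun x => (mix x.1 x.2, mix x.2 x.1)
      invFun := fun x => (mix x.1 x.2, mix x.2 x.1)
      left_inv := by
        rintro ⟨τ, τ'⟩
        ext v <;> by_cases hv : v ∈ A <;> simp [mix, hv]
      right_inv := by
        rintro ⟨τ, τ'⟩
        ext v <;> by_cases hv : v ∈ A <;> simp [mix, hv] }
  have h1 : (∑ τ, f τ) * ∑ τ, g τ = (q : ℝ) ^ Fintype.card V * ∑ τ, f τ * g τ := by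
    rw [Finset.sum_mul_sum, ← Finset.sum_product', Finset.univ_product_univ, ← φ.sum_comp]
    have h2 : ∀ x : (V → Fin q) × (V → Fin q), f (φ x).1 * g (φ x).2 = f x.1 * g x.1 := by
      rintro ⟨τ, τ'⟩
      congr 1
      · refine hf fun v hv => ?_
        simp [φ, mix, hv]
      · refine hg fun v hv => ?_
        have : v ∉ A := fun h => Set.disjoint_left.mp hAB h hv
        simp [φ, mix, this]
    simp only [h2]
    rw [← Finset.univ_product_univ, Finset.sum_product, Finset.mul_sum]
    refine Finset.sum_congr rfl fun τ _ => ?_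
    simp
  have hpos := pow_card_pos (V := V) hq
  rw [avg, avg, avg, div_mul_div_comm, h1]
  field_simp

end Average

section Mono

variable {V : Type*} [Fintype V] [DecidableEq V] {q : ℕ}

/-- All edges of `ω` are monochromatic for `τ`. -/
def IsMono (ω : Finset (Sym2 V)) (τ : V → Fin q) : Prop :=
  ∀ e ∈ ω, (e.map τ).IsDiag

/-- The edges of `ω` that are monochromatic for `σ`. -/
def keep (ω : Finset (Sym2 V)) (σ : V → Fin q) : Finset (Sym2 V) :=
  ω.filter fun e => (e.map σ).IsDiag

/-- The set of endpoints of the edges in `ω`. -/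
def verts (ω : Finset (Sym2 V)) : Set V := {v | ∃ e ∈ ω, v ∈ e}

open Classical in
/-- The indicator of `IsMono ω`. -/
noncomputable def monoInd (ω : Finset (Sym2 V)) (τ : V → Fin q) : ℝ :=
  if IsMono ω τ then 1 else 0

variable (q) in
/-- The probability that all edges of `ω` are monochromatic for a uniform colouring. -/
noncomputable def monoProb (ω : Finset (Sym2 V)) : ℝ :=
  avg (monoInd (q := q) ω)

/-- The density, with respect to the uniform law on colourings, of the uniform law on colourings
for which `ω` is monochromatic. -/
noncomputable def dens (ω : Finset (Sym2 V)) (τ : V → Fin q) : ℝ :=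
  (monoProb q ω)⁻¹ * monoInd ω τ

lemma keep_subset (ω : Finset (Sym2 V)) (σ : V → Fin q) : keep ω σ ⊆ ω :=
  Finset.filter_subset _ _

lemma keep_union (ω ω' : Finset (Sym2 V)) (σ : V → Fin q) :
    keep (ω ∪ ω') σ = keep ω σ ∪ keep ω' σ :=
  Finset.filter_union _ _ _

lemma keep_empty (σ : V → Fin q) : keep ∅ σ = ∅ := Finset.filter_empty _

lemma verts_mono {ω ω' : Finset (Sym2 V)} (h : ω ⊆ ω') : verts ω ⊆ verts ω' :=
  fun _ ⟨e, he, hv⟩ => ⟨e, h he, hv⟩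

lemma isDiag_map_congr {e : Sym2 V} {σ τ : V → Fin q} (h : ∀ v ∈ e, σ v = τ v) :
    e.map σ = e.map τ := Sym2.map_congr h

lemma dependsOn_keep (ω : Finset (Sym2 V)) : DependsOn (keep (q := q) ω) (verts ω) := by
  intro σ τ h
  refine Finset.filter_congr fun e he => ?_
  rw [isDiag_map_congr fun v hv => h v ⟨e, he, hv⟩]

lemma dependsOn_monoInd (ω : Finset (Sym2 V)) : DependsOn (monoInd (q := q) ω) (verts ω) := by
  intro σ τ h
  have : IsMono ω σ ↔ IsMono ω τ := by
    refine forall₂_congr fun e he => ?_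
    rw [isDiag_map_congr fun v hv => h v ⟨e, he, hv⟩]
  by_cases h1 : IsMono ω τ
  · rw [monoInd, monoInd, if_pos h1, if_pos (this.mpr h1)]
  · rw [monoInd, monoInd, if_neg h1, if_neg (mt this.mp h1)]

lemma dependsOn_dens (ω : Finset (Sym2 V)) : DependsOn (dens (q := q) ω) (verts ω) :=
  fun σ τ h => by rw [dens, dens, dependsOn_monoInd ω h]

lemma monoInd_nonneg (ω : Finset (Sym2 V)) (τ : V → Fin q) : 0 ≤ monoInd ω τ := by
  unfold monoInd
  split_ifs <;> norm_num

lemma monoInd_union (ω ω' : Finset (Sym2 V)) (τ : V → Fin q) :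
    monoInd (ω ∪ ω') τ = monoInd ω τ * monoInd ω' τ := by
  have h : IsMono (ω ∪ ω') τ ↔ IsMono ω τ ∧ IsMono ω' τ := by
    simp only [IsMono, Finset.mem_union, or_imp, forall_and]
  by_cases h1 : IsMono ω τ <;> by_cases h2 : IsMono ω' τ <;> simp [monoInd, h, h1, h2]

lemma monoInd_anti {ω ω' : Finset (Sym2 V)} (h : ω ⊆ ω') (τ : V → Fin q) :
    monoInd ω' τ ≤ monoInd ω τ := by
  unfold monoInd
  split_ifs with h1 h2
  · exact le_rfl
  · exact absurd (fun e he => h1 e (h he)) h2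
  · norm_num
  · exact le_rfl

lemma monoInd_keep (ω : Finset (Sym2 V)) (τ : V → Fin q) : monoInd (keep ω τ) τ = 1 :=
  if_pos fun _ he => (Finset.mem_filter.mp he).2

lemma monoInd_le_one (ω : Finset (Sym2 V)) (τ : V → Fin q) : monoInd ω τ ≤ 1 := by
  unfold monoInd
  split_ifs <;> norm_num

lemma monoProb_empty (hq : 0 < q) : monoProb q (∅ : Finset (Sym2 V)) = 1 := by
  rw [← avg_one (V := V) hq, monoProb]
  congr 1
  ext τ
  exact if_pos fun e he => absurd he (Finset.notMem_empty e)

lemma dens_empty (hq : 0 < q) (τ : V → Fin q) : dens ∅ τ = 1 := by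
  rw [dens, monoProb_empty hq, inv_one, one_mul]
  exact if_pos fun e he => absurd he (Finset.notMem_empty e)

/-- Colourings constant on all endpoints of `ω` show that `ω` is monochromatic with probability at
least `q ^ (-2 |ω|)`. -/
lemma inv_monoProb_le_pow (hq : 0 < q) (ω : Finset (Sym2 V)) :
    (monoProb q ω)⁻¹ ≤ (q : ℝ) ^ (2 * ω.card) ∧ 0 < monoProb q ω := by
  classical
  have : NeZero q := ⟨hq.ne'⟩
  let Vs : Finset V := ω.biUnion fun e => e.toFinset
  have hVs : Vs.card ≤ 2 * ω.card := by
    rw [mul_comm]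
    refine Finset.card_biUnion_le_card_mul _ _ _ fun e _ => ?_
    rw [Sym2.card_toFinset]
    split_ifs <;> norm_num
  let F : Finset (V → Fin q) := Fintype.piFinset fun v => if v ∈ Vs then {0} else Finset.univ
  have hFcard : (F.card : ℝ) * (q : ℝ) ^ Vs.card = (q : ℝ) ^ Fintype.card V := by
    have h1 : F.card = ∏ v, if v ∈ Vs then 1 else q := by
      rw [Fintype.card_piFinset]
      refine Finset.prod_congr rfl fun v _ => ?_
      split_ifs <;> simp
    have h2 : (q : ℕ) ^ Vs.card = ∏ v, if v ∈ Vs then q else 1 := by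
      rw [Finset.prod_ite_mem, Finset.univ_inter, Finset.prod_const]
    have h3 : F.card * q ^ Vs.card = q ^ Fintype.card V := by
      rw [h1, h2, ← Finset.prod_mul_distrib, ← Finset.card_univ, ← Finset.prod_const]
      refine Finset.prod_congr rfl fun v _ => ?_
      split_ifs <;> simp
    exact_mod_cast h3
  have hFmono : ∀ τ ∈ F, monoInd ω τ = 1 := by
    intro τ hτ
    refine if_pos fun e he => ?_
    have h0 : ∀ v ∈ e, τ v = 0 := by
      intro v hv
      have h1 := Fintype.mem_piFinset.mp hτ v
      have h2 : v ∈ Vs := Finset.mem_biUnion.mpr ⟨e, he, Sym2.mem_toFinset.mpr hv⟩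
      rw [if_pos h2] at h1
      exact Finset.mem_singleton.mp h1
    induction e with
    | h u v =>
      rw [Sym2.map_mk, Sym2.mk_isDiag_iff]
      exact (h0 u (Sym2.mem_mk_left u v)).trans (h0 v (Sym2.mem_mk_right u v)).symm
  have hsum : (F.card : ℝ) ≤ ∑ τ, monoInd (q := q) ω τ := by
    calc (F.card : ℝ) = ∑ τ ∈ F, monoInd (q := q) ω τ := by
          rw [Finset.sum_congr rfl hFmono]; simp
      _ ≤ _ := Finset.sum_le_univ_sum_of_nonneg fun τ => monoInd_nonneg ω τ
  have hq1 : (1 : ℝ) ≤ q := by exact_mod_cast hq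
  have hqV : (0 : ℝ) < (q : ℝ) ^ Vs.card := by positivity
  have hpos := pow_card_pos (V := V) hq
  have hge : ((q : ℝ) ^ Vs.card)⁻¹ ≤ monoProb q ω := by
    rw [monoProb, avg, le_div_iff₀ hpos, ← hFcard]
    field_simp
    exact hsum
  refine ⟨?_, (inv_pos.mpr hqV).trans_le hge⟩
  refine (inv_le_of_inv_le₀ hqV hge).trans ?_
  exact pow_le_pow_right₀ hq1 hVs

lemma monoProb_pos (hq : 0 < q) (ω : Finset (Sym2 V)) : 0 < monoProb q ω :=
  (inv_monoProb_le_pow hq ω).2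

lemma monoProb_anti {ω ω' : Finset (Sym2 V)} (h : ω ⊆ ω') :
    monoProb q ω' ≤ monoProb q ω :=
  avg_mono fun τ => monoInd_anti h τ

lemma monoProb_union (hq : 0 < q) {ω ω' : Finset (Sym2 V)} (h : Disjoint (verts ω) (verts ω')) :
    monoProb q (ω ∪ ω') = monoProb q ω * monoProb q ω' := by
  rw [monoProb, monoProb, monoProb, ← avg_mul_of_dependsOn hq (dependsOn_monoInd ω)
    (dependsOn_monoInd ω') h]
  congr 1
  ext τ
  exact monoInd_union ω ω' τ

lemma dens_union (hq : 0 < q) {ω ω' : Finset (Sym2 V)} (h : Disjoint (verts ω) (verts ω'))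
    (τ : V → Fin q) : dens (ω ∪ ω') τ = dens ω τ * dens ω' τ := by
  rw [dens, dens, dens, monoProb_union hq h, monoInd_union, mul_inv]
  ring

lemma dens_nonneg (hq : 0 < q) (ω : Finset (Sym2 V)) (τ : V → Fin q) : 0 ≤ dens ω τ :=
  mul_nonneg (inv_nonneg.mpr (monoProb_pos hq ω).le) (monoInd_nonneg ω τ)

lemma avg_dens (hq : 0 < q) (ω : Finset (Sym2 V)) : avg (dens (q := q) ω) = 1 := by
  change avg (fun τ => (monoProb q ω)⁻¹ * monoInd ω τ) = 1
  rw [avg_const_mul]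
  exact inv_mul_cancel₀ (monoProb_pos hq ω).ne'

end Mono

/-! ### Densities of histories of percolation layers. -/

section History

variable {V : Type*} [Fintype V] [DecidableEq V] {q : ℕ}

/-- For percolation configurations `L 0, …, L k`, the density at `y` (with respect to the uniform
law) of the colouring obtained from `σ` by first keeping the monochromatic edges of `L k` and
recolouring, then those of `L (k - 1)`, and so on down to `L 0`. -/
noncomputable def pathDens (L : ℕ → Finset (Sym2 V)) (y : V → Fin q) : ℕ → (V → Fin q) → ℝ
  | 0, σ => dens (keep (L 0) σ) y
  | k + 1, σ => avg fun τ => dens (keep (L (k + 1)) σ) τ * pathDens L y k τ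

lemma pathDens_nonneg (hq : 0 < q) (L : ℕ → Finset (Sym2 V)) (y : V → Fin q) (k : ℕ)
    (σ : V → Fin q) : 0 ≤ pathDens L y k σ := by
  induction k generalizing σ with
  | zero => exact dens_nonneg hq _ _
  | succ k ih => exact avg_nonneg fun τ => mul_nonneg (dens_nonneg hq _ _) (ih τ)

lemma pathDens_congr {L L' : ℕ → Finset (Sym2 V)} (y : V → Fin q) (k : ℕ)
    (h : ∀ i ≤ k, L i = L' i) (σ : V → Fin q) : pathDens L y k σ = pathDens L' y k σ := by
  induction k generalizing σ with
  | zero => rw [pathDens, pathDens, h 0 le_rfl]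
  | succ k ih =>
    rw [pathDens, pathDens, h (k + 1) le_rfl]
    congr 1
    ext τ
    rw [ih (fun i hi => h i (by omega))]

lemma dependsOn_pathDens (L : ℕ → Finset (Sym2 V)) (y : V → Fin q) (k : ℕ) :
    DependsOn (pathDens L y k) (verts (L k)) := by
  intro σ τ h
  cases k with
  | zero => rw [pathDens, pathDens, dependsOn_keep _ h]
  | succ k => rw [pathDens, pathDens, dependsOn_keep _ h]

/-- Histories that touch disjoint sets of vertices at the same and at consecutive times are
independent. -/
lemma pathDens_union (hq : 0 < q) (L L' : ℕ → Finset (Sym2 V)) (y : V → Fin q) (k : ℕ)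
    (h0 : ∀ i ≤ k, Disjoint (verts (L i)) (verts (L' i)))
    (h1 : ∀ i < k, Disjoint (verts (L i)) (verts (L' (i + 1))))
    (h2 : ∀ i < k, Disjoint (verts (L (i + 1))) (verts (L' i))) (σ : V → Fin q) :
    pathDens (fun i => L i ∪ L' i) y k σ = pathDens L y k σ * pathDens L' y k σ := by
  have hkeep : ∀ i ≤ k, ∀ σ : V → Fin q,
      Disjoint (verts (keep (L i) σ)) (verts (keep (L' i) σ)) := fun i hi σ =>
    (h0 i hi).mono (verts_mono (keep_subset _ _)) (verts_mono (keep_subset _ _))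
  induction k generalizing σ with
  | zero =>
    rw [pathDens, pathDens, pathDens, keep_union, dens_union hq (hkeep 0 le_rfl σ)]
  | succ k ih =>
    rw [pathDens, pathDens, pathDens]
    -- The intermediate colouring `τ` is constrained by layer `k + 1`, which produced it, and is
    -- read by layer `k`. Hence disjointness is also needed at consecutive times.
    rw [← avg_mul_of_dependsOn (A := verts (L (k + 1)) ∪ verts (L k))
      (B := verts (L' (k + 1)) ∪ verts (L' k)) hq]
    · congr 1
      ext τ
      rw [ih (fun i hi => h0 i (by omega)) (fun i hi => h1 i (by omega))
        (fun i hi => h2 i (by omega)) τ (fun i hi => hkeep i (by omega)), keep_union,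
        dens_union hq (hkeep (k + 1) le_rfl σ)]
      ring
    · intro τ τ' h
      beta_reduce
      rw [dependsOn_dens _ fun v hv => h v (Or.inl (verts_mono (keep_subset _ _) hv)),
        dependsOn_pathDens L y k fun v hv => h v (Or.inr hv)]
    · intro τ τ' h
      beta_reduce
      rw [dependsOn_dens _ fun v hv => h v (Or.inl (verts_mono (keep_subset _ _) hv)),
        dependsOn_pathDens L' y k fun v hv => h v (Or.inr hv)]
    · rw [Set.disjoint_union_left, Set.disjoint_union_right, Set.disjoint_union_right]
      exact ⟨⟨h0 _ le_rfl, h2 k (by omega)⟩, h1 k (by omega), h0 k (by omega)⟩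

/-- With no edge in the last step, the final colouring is uniform whatever happened before. -/
lemma pathDens_eq_one (hq : 0 < q) (L : ℕ → Finset (Sym2 V)) (y : V → Fin q) (k : ℕ)
    (h : L 0 = ∅) (σ : V → Fin q) : pathDens L y k σ = 1 := by
  induction k generalizing σ with
  | zero => rw [pathDens, h, keep_empty, dens_empty hq]
  | succ k ih =>
    rw [pathDens]
    simp only [ih, mul_one]
    exact avg_dens hq _

lemma pathDens_eq_of_empty (L : ℕ → Finset (Sym2 V)) (y : V → Fin q) (k : ℕ)
    (h : L k = ∅) (σ σ' : V → Fin q) : pathDens L y k σ = pathDens L y k σ' :=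
  dependsOn_pathDens L y k fun v hv => by
    rw [h] at hv
    obtain ⟨e, he, -⟩ := hv
    exact absurd he (Finset.notMem_empty e)

lemma avg_dens_mul_le (hq : 0 < q) {ω : Finset (Sym2 V)} {f : (V → Fin q) → ℝ} {b : ℝ}
    (h : ∀ τ, f τ ≤ b) : avg (fun τ => dens ω τ * f τ) ≤ b := by
  calc avg (fun τ => dens ω τ * f τ) ≤ avg (fun τ => b * dens ω τ) :=
        avg_mono fun τ => by
          rw [mul_comm]
          exact mul_le_mul_of_nonneg_right (h τ) (dens_nonneg hq _ _)
    _ = b := by rw [avg_const_mul]; exact (congrArg (b * ·) (avg_dens hq ω)).trans (mul_one b)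

lemma inv_monoProb_le (hq : 0 < q) {ω ω' : Finset (Sym2 V)} (h : ω ⊆ ω') :
    (monoProb q ω)⁻¹ ≤ (monoProb q ω')⁻¹ :=
  inv_anti₀ (monoProb_pos hq ω') (monoProb_anti h)

/-- Sum over the `2^|ω|` possible values `ζ` of `keep ω τ`. Given `κ`, the edges of `ζ` are
monochromatic with probability at most `monoProb q ζ / monoProb q κ`, and the numerator cancels the
inverse. -/
lemma avg_dens_mul_inv_le (hq : 0 < q) (κ ω : Finset (Sym2 V)) :
    avg (fun τ : V → Fin q => dens κ τ * (monoProb q (keep ω τ))⁻¹) ≤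
      2 ^ ω.card * (monoProb q κ)⁻¹ := by
  calc avg (fun τ : V → Fin q => dens κ τ * (monoProb q (keep ω τ))⁻¹)
      ≤ avg (fun τ : V → Fin q => ∑ ζ ∈ ω.powerset,
          ((monoProb q κ)⁻¹ * (monoProb q ζ)⁻¹) * monoInd (κ ∪ ζ) τ) := by
        refine avg_mono fun τ => ?_
        have hterm : dens κ τ * (monoProb q (keep ω τ))⁻¹ =
            ((monoProb q κ)⁻¹ * (monoProb q (keep ω τ))⁻¹) * monoInd (κ ∪ keep ω τ) τ := by
          rw [dens, monoInd_union, monoInd_keep]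
          ring
        rw [hterm]
        refine Finset.single_le_sum
          (f := fun ζ => ((monoProb q κ)⁻¹ * (monoProb q ζ)⁻¹) * monoInd (κ ∪ ζ) τ)
          (fun ζ _ => ?_) (Finset.mem_powerset.mpr (keep_subset ω τ))
        exact mul_nonneg (mul_nonneg (inv_nonneg.mpr (monoProb_pos hq _).le)
          (inv_nonneg.mpr (monoProb_pos hq _).le)) (monoInd_nonneg _ _)
    _ = ∑ ζ ∈ ω.powerset, ((monoProb q κ)⁻¹ * (monoProb q ζ)⁻¹) * monoProb q (κ ∪ ζ) := by
        rw [avg_sum]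
        exact Finset.sum_congr rfl fun ζ _ => avg_const_mul _ _
    _ ≤ ∑ ζ ∈ ω.powerset, (monoProb q κ)⁻¹ := by
        refine Finset.sum_le_sum fun ζ _ => ?_
        have h1 : (monoProb q ζ)⁻¹ * monoProb q (κ ∪ ζ) ≤ 1 := by
          rw [inv_mul_le_iff₀ (monoProb_pos hq ζ), mul_one]
          exact monoProb_anti Finset.subset_union_right
        rw [mul_assoc]
        exact mul_le_of_le_one_right (inv_nonneg.mpr (monoProb_pos hq _).le) h1
    _ = 2 ^ ω.card * (monoProb q κ)⁻¹ := by
        rw [Finset.sum_const, Finset.card_powerset, nsmul_eq_mul]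
        push_cast
        rfl

/-- The inverse probability is passed from each layer to the one above it, at a cost of `2^|L i|`
per layer. -/
lemma pathDens_le_keep (hq : 0 < q) (L : ℕ → Finset (Sym2 V)) (y : V → Fin q) (k : ℕ)
    (σ : V → Fin q) : pathDens L y k σ ≤
      2 ^ (∑ i ∈ Finset.range k, (L i).card) * (monoProb q (keep (L k) σ))⁻¹ := by
  induction k generalizing σ with
  | zero =>
    rw [pathDens, Finset.range_zero, Finset.sum_empty, pow_zero, one_mul, dens]
    exact mul_le_of_le_one_right (inv_nonneg.mpr (monoProb_pos hq _).le) (monoInd_le_one _ _)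
  | succ k ih =>
    rw [pathDens]
    calc avg (fun τ => dens (keep (L (k + 1)) σ) τ * pathDens L y k τ)
        ≤ avg (fun τ => 2 ^ (∑ i ∈ Finset.range k, (L i).card) *
            (dens (keep (L (k + 1)) σ) τ * (monoProb q (keep (L k) τ))⁻¹)) :=
          avg_mono fun τ => by
            rw [mul_left_comm]
            exact mul_le_mul_of_nonneg_left (ih τ) (dens_nonneg hq _ _)
      _ ≤ _ := by
          rw [avg_const_mul, Finset.sum_range_succ, pow_add, mul_assoc]
          exact mul_le_mul_of_nonneg_left (avg_dens_mul_inv_le hq _ _) (by positivity)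

/-- The layer `i` that pays the power of `q` is free to choose: above it, averaging against a
density cannot increase a uniform bound. -/
lemma pathDens_le (hq : 0 < q) (L : ℕ → Finset (Sym2 V)) (y : V → Fin q) {i k : ℕ} (hik : i ≤ k)
    (σ : V → Fin q) : pathDens L y k σ ≤
      2 ^ (∑ j ∈ Finset.range (k + 1), (L j).card) * (q : ℝ) ^ (2 * (L i).card) := by
  have key : ∀ k, i ≤ k → ∀ σ, pathDens L y k σ ≤
      2 ^ (∑ j ∈ Finset.range i, (L j).card) * (q : ℝ) ^ (2 * (L i).card) := by
    intro k hik
    induction k, hik using Nat.le_induction with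
    | base =>
      intro σ
      refine (pathDens_le_keep hq L y i σ).trans (mul_le_mul_of_nonneg_left ?_ (by positivity))
      exact (inv_monoProb_le hq (keep_subset _ _)).trans (inv_monoProb_le_pow hq _).1
    | succ k _ ih => exact fun σ => avg_dens_mul_le hq ih
  refine (key k hik σ).trans (mul_le_mul_of_nonneg_right ?_ (by positivity))
  exact pow_le_pow_right₀ one_le_two (Finset.sum_le_sum_of_subset
    (Finset.range_mono (by omega)))

/-- If `q ^ 2 ≤ 2 ^ (k + 1)`, the least occupied layer pays for the factor `q`. -/
lemma pathDens_le_four_pow (hq : 0 < q) (L : ℕ → Finset (Sym2 V)) (y : V → Fin q) {k : ℕ}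
    (hqk : q ^ 2 ≤ 2 ^ (k + 1)) (σ : V → Fin q) :
    pathDens L y k σ ≤ 4 ^ (∑ j ∈ Finset.range (k + 1), (L j).card) := by
  obtain ⟨i, hi, hmin⟩ := Finset.exists_min_image (Finset.range (k + 1)) (fun j => (L j).card)
    ⟨0, Finset.mem_range.mpr (by omega)⟩
  -- The least occupied layer holds at most a `1/(k+1)` share of the edges, so `q^(2|L i|) ≤
  -- 2^((k+1)|L i|)` is at most 2 to the total number of edges.
  have hsum : (k + 1) * (L i).card ≤ ∑ j ∈ Finset.range (k + 1), (L j).card := by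
    have := Finset.card_nsmul_le_sum (Finset.range (k + 1)) (fun j => (L j).card) _ hmin
    simpa using this
  refine (pathDens_le hq L y (Nat.lt_succ_iff.mp (Finset.mem_range.mp hi)) σ).trans ?_
  have h4 : (4 : ℝ) = 2 * 2 := by norm_num
  rw [h4, mul_pow]
  refine mul_le_mul_of_nonneg_left ?_ (by positivity)
  have h1 : (q : ℝ) ^ 2 ≤ 2 ^ (k + 1) := by exact_mod_cast hqk
  calc (q : ℝ) ^ (2 * (L i).card) = ((q : ℝ) ^ 2) ^ (L i).card := pow_mul _ _ _
    _ ≤ ((2 : ℝ) ^ (k + 1)) ^ (L i).card := pow_le_pow_left₀ (by positivity) h1 _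
    _ = 2 ^ ((k + 1) * (L i).card) := (pow_mul _ _ _).symm
    _ ≤ _ := pow_le_pow_right₀ one_le_two hsum

end History

lemma sum_powerset_union {α : Type*} [DecidableEq α] {A B : Finset α} (h : Disjoint A B)
    (f : Finset α → ℝ) :
    ∑ η ∈ (A ∪ B).powerset, f η = ∑ a ∈ A.powerset, ∑ b ∈ B.powerset, f (a ∪ b) := by
  rw [← Finset.sum_product']
  have hAB := Finset.disjoint_left.mp h
  refine Finset.sum_nbij' (fun η => (η ∩ A, η ∩ B)) (fun x => x.1 ∪ x.2) ?_ ?_ ?_ ?_ ?_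
  · intro η _
    simp only [Finset.mem_product, Finset.mem_powerset]
    exact ⟨Finset.inter_subset_right, Finset.inter_subset_right⟩
  · rintro ⟨a, b⟩ hab
    simp only [Finset.mem_product, Finset.mem_powerset] at hab ⊢
    exact Finset.union_subset_union hab.1 hab.2
  · intro η hη
    rw [Finset.mem_powerset] at hη
    simp only
    rw [← Finset.inter_union_distrib_left, Finset.inter_eq_left.mpr hη]
  · rintro ⟨a, b⟩ hab
    simp only [Finset.mem_product, Finset.mem_powerset] at hab
    ext e
    · simp only [Finset.mem_inter, Finset.mem_union]
      exact ⟨fun ⟨h1, h2⟩ => h1.resolve_right fun h3 => hAB h2 (hab.2 h3),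
        fun h1 => ⟨Or.inl h1, hab.1 h1⟩⟩
    · simp only [Finset.mem_inter, Finset.mem_union]
      exact ⟨fun ⟨h1, h2⟩ => h1.resolve_left fun h3 => hAB (hab.1 h3) h2,
        fun h1 => ⟨Or.inr h1, hab.2 h1⟩⟩
  · intro η hη
    rw [Finset.mem_powerset] at hη
    simp only
    rw [← Finset.inter_union_distrib_left, Finset.inter_eq_left.mpr hη]

lemma sum_powerset_pow_card {α : Type*} (A : Finset α) (z : ℝ) :
    ∑ ω ∈ A.powerset, z ^ ω.card = (1 + z) ^ A.card := by
  have h := Finset.sum_pow_mul_eq_add_pow z 1 A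
  simp only [one_pow, mul_one] at h
  rw [h, add_comm]

/-! ### The kernel in percolation form, and reversibility. -/

section Recolour

variable {V : Type*} [Fintype V] [DecidableEq V] {q : ℕ}

lemma forall_reachable_iff_isMono (ω : Finset (Sym2 V)) (τ : V → Fin q) :
    (∀ u v : V, (fromEdgeSet (ω : Set (Sym2 V))).Reachable u v → τ u = τ v) ↔ IsMono ω τ := by
  constructor
  · intro h e he
    induction e with
    | h u v =>
      rw [Sym2.map_mk, Sym2.mk_isDiag_iff]
      by_cases huv : u = v
      · rw [huv]
      · exact h u v (Adj.reachable ((fromEdgeSet_adj _).mpr ⟨he, huv⟩))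
  · intro h u v huv
    have huv' := (reachable_iff_reflTransGen u v).mp huv
    clear huv
    induction huv' with
    | refl => rfl
    | @tail b c _ hbc ih =>
      rw [fromEdgeSet_adj] at hbc
      have := h s(b, c) hbc.1
      rw [Sym2.map_mk, Sym2.mk_isDiag_iff] at this
      exact ih.trans this

/-- Colourings for which `ω` is monochromatic are colourings of the components of `(V, ω)`. -/
def isMonoEquiv (ω : Finset (Sym2 V)) :
    {τ : V → Fin q // IsMono ω τ} ≃
      ((fromEdgeSet (ω : Set (Sym2 V))).ConnectedComponent → Fin q) where
  toFun τ := fun c => c.lift τ.1 fun u v p _ =>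
    (forall_reachable_iff_isMono ω τ.1).mpr τ.2 u v p.reachable
  invFun g := ⟨fun v => g (connectedComponentMk _ v), (forall_reachable_iff_isMono ω _).mp
    fun _ _ h => congrArg g (ConnectedComponent.sound h)⟩
  left_inv _ := rfl
  right_inv g := by
    ext c
    induction c using ConnectedComponent.ind
    rfl

lemma monoProb_eq (ω : Finset (Sym2 V)) :
    monoProb q ω = (q : ℝ) ^ Nat.card (fromEdgeSet (ω : Set (Sym2 V))).ConnectedComponent /
      (q : ℝ) ^ Fintype.card V := by
  classical
  rw [monoProb, avg]
  congr 1
  simp only [monoInd, Finset.sum_boole]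
  have h := Nat.card_congr (isMonoEquiv (q := q) ω)
  rw [Nat.card_fun, Nat.card_eq_fintype_card (α := Fin q), Fintype.card_fin,
    Nat.card_eq_fintype_card, Fintype.card_subtype] at h
  exact_mod_cast h

lemma recolourProb_eq (hq : 0 < q) (ω : Finset (Sym2 V)) (τ : V → Fin q) :
    recolourProb ω τ = dens ω τ / (q : ℝ) ^ Fintype.card V := by
  have hpos := pow_card_pos (V := V) hq
  have hpos' : (0 : ℝ) < (q : ℝ) ^
    Nat.card (fromEdgeSet (ω : Set (Sym2 V))).ConnectedComponent := by positivity
  rw [recolourProb, dens, monoInd, monoProb_eq]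
  by_cases h : IsMono ω τ
  · rw [if_pos h, if_pos ((forall_reachable_iff_isMono ω τ).mpr h)]
    field_simp
  · rw [if_neg h, if_neg (mt (forall_reachable_iff_isMono ω τ).mp h)]
    simp

lemma sum_recolourProb_mul (hq : 0 < q) (ω : Finset (Sym2 V)) (f : (V → Fin q) → ℝ) :
    ∑ τ, recolourProb ω τ * f τ = avg fun τ => dens ω τ * f τ := by
  rw [avg, Finset.sum_div]
  refine Finset.sum_congr rfl fun τ _ => ?_
  rw [recolourProb_eq hq]
  ring

end Recolour

section Kernel

variable {V : Type*} [Fintype V] [DecidableEq V] (G : SimpleGraph V) [DecidableRel G.Adj] {q : ℕ}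

lemma one_add_odds {p : ℝ} (hp1 : p < 1) : 1 + p / (1 - p) = (1 - p)⁻¹ := by
  have : 1 - p ≠ 0 := by linarith
  field_simp
  ring

lemma bernoulli_weight_eq {p : ℝ} (hp1 : p < 1) {α : Type*} [DecidableEq α] {a M : Finset α}
    (h : a ⊆ M) : p ^ a.card * (1 - p) ^ (M \ a).card =
      (1 - p) ^ M.card * (p / (1 - p)) ^ a.card := by
  have h1 : 1 - p ≠ 0 := by linarith
  rw [← Finset.card_sdiff_add_card_eq_card h, pow_add, div_pow]
  field_simp

/-- Percolating on all edges and then discarding those not monochromatic for `σ` gives the same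
kernel, as the discarded edges sum out. The percolation weights no longer depend on `σ`, so steps
can be composed. -/
lemma kernel_eq_sum_odds {p : ℝ} (hp1 : p < 1) (σ τ : V → Fin q) :
    kernel G q p σ τ = (1 - p) ^ G.edgeFinset.card *
      ∑ ω ∈ G.edgeFinset.powerset, (p / (1 - p)) ^ ω.card * recolourProb (keep ω σ) τ := by
  set M := monoEdges G σ
  set E := G.edgeFinset
  have hME : M ⊆ E := keep_subset _ _
  have h1 : (1 - p) ≠ 0 := by linarith
  have hE : E = M ∪ (E \ M) := (Finset.union_sdiff_of_subset hME).symm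
  have hcard : E.card = M.card + (E \ M).card := by
    rw [add_comm, Finset.card_sdiff_add_card_eq_card hME]
  have hsum : ∑ ω ∈ E.powerset, (p / (1 - p)) ^ ω.card * recolourProb (keep ω σ) τ =
      ∑ a ∈ M.powerset, ∑ b ∈ (E \ M).powerset,
        (p / (1 - p)) ^ a.card * recolourProb a τ * (p / (1 - p)) ^ b.card := by
    conv_lhs => rw [hE]
    rw [sum_powerset_union Finset.disjoint_sdiff]
    refine Finset.sum_congr rfl fun a ha => Finset.sum_congr rfl fun b hb => ?_
    rw [Finset.mem_powerset] at ha hb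
    have hk : keep (a ∪ b) σ = a := by
      rw [keep_union]
      have ha' : keep a σ = a :=
        Finset.filter_true_of_mem fun e he => (Finset.mem_filter.mp (ha he)).2
      have hb' : keep b σ = ∅ := by
        refine Finset.filter_false_of_mem fun e he h => ?_
        have := Finset.mem_sdiff.mp (hb he)
        exact this.2 (Finset.mem_filter.mpr ⟨this.1, h⟩)
      rw [ha', hb', Finset.union_empty]
    rw [hk, Finset.card_union_of_disjoint
      (Finset.disjoint_of_subset_left ha (Finset.disjoint_of_subset_right hb
        Finset.disjoint_sdiff)), pow_add]
    ring
  rw [hsum]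
  simp only [← Finset.mul_sum, sum_powerset_pow_card, one_add_odds hp1]
  rw [← Finset.sum_mul, mul_comm (∑ a ∈ M.powerset, _), ← mul_assoc, hcard, pow_add, mul_assoc
    ((1 - p) ^ M.card), ← mul_pow, mul_inv_cancel₀ h1, one_pow, mul_one, Finset.mul_sum]
  refine Finset.sum_congr rfl fun a ha => ?_
  rw [Finset.mem_powerset] at ha
  change p ^ a.card * (1 - p) ^ (M \ a).card * _ = _
  rw [bernoulli_weight_eq hp1 ha, mul_assoc]

/-- Edwards–Sokal coupling: `exp β * (1 - p) = 1` cancels the Potts weight against the closed edges.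
What remains is symmetric in `σ` and `τ`, which gives reversibility. -/
lemma pottsWeight_mul_kernel (hq : 0 < q) {p β : ℝ} (hpβ : p = 1 - Real.exp (-β))
    (σ τ : V → Fin q) : pottsWeight G β σ * kernel G q p σ τ =
      ∑ ω ∈ G.edgeFinset.powerset, (p / (1 - p)) ^ ω.card * (monoProb q ω)⁻¹ *
        (monoInd ω σ * monoInd ω τ) / (q : ℝ) ^ Fintype.card V := by
  have hexp : 1 - p = Real.exp (-β) := by rw [hpβ]; ring
  have hp1 : p < 1 := by linarith [Real.exp_pos (-β)]
  set M := monoEdges G σ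
  have hw : pottsWeight G β σ * (1 - p) ^ M.card = 1 := by
    rw [pottsWeight, hexp, ← Real.exp_nat_mul, ← Real.exp_add, ← Real.exp_zero]
    congr 1
    ring
  have hK : kernel G q p σ τ = (1 - p) ^ M.card * ∑ a ∈ M.powerset,
      (p / (1 - p)) ^ a.card * recolourProb a τ := by
    rw [Finset.mul_sum]
    refine Finset.sum_congr rfl fun a ha => ?_
    rw [Finset.mem_powerset] at ha
    change p ^ a.card * (1 - p) ^ (M \ a).card * _ = _
    rw [bernoulli_weight_eq hp1 ha, mul_assoc]
  rw [hK, ← mul_assoc, hw, one_mul]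
  have hsub : M.powerset ⊆ G.edgeFinset.powerset := Finset.powerset_mono.mpr (keep_subset _ _)
  rw [← Finset.sum_subset hsub]
  · refine Finset.sum_congr rfl fun a ha => ?_
    have hmono : monoInd a σ = 1 := if_pos fun e he =>
      (Finset.mem_filter.mp (Finset.mem_powerset.mp ha he)).2
    rw [recolourProb_eq hq, dens, hmono]
    ring
  · intro a ha haM
    have hmono : monoInd a σ = 0 := by
      refine if_neg fun h => haM (Finset.mem_powerset.mpr fun e he => ?_)
      exact Finset.mem_filter.mpr ⟨Finset.mem_powerset.mp ha he, h e he⟩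
    rw [hmono]
    simp

/-- The Swendsen–Wang dynamics is reversible with respect to the Potts measure. -/
lemma isReversibleChain_kernel (hq : 0 < q) {p β : ℝ} (hp : 0 < p)
    (hpβ : p = 1 - Real.exp (-β)) : IsReversibleChain (kernel G q p) (potts G β) := by
  have hp1 : p < 1 := by linarith [Real.exp_pos (-β)]
  have : NeZero q := ⟨hq.ne'⟩
  have hw : ∀ σ : V → Fin q, 0 < pottsWeight G β σ := fun σ => Real.exp_pos _
  have hZ : 0 < ∑ τ : V → Fin q, pottsWeight G β τ :=
    Finset.sum_pos (fun τ _ => hw τ) Finset.univ_nonempty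
  have hdens : ∀ ω : Finset (Sym2 V), ∑ τ : V → Fin q, recolourProb ω τ = 1 := by
    intro ω
    have h := sum_recolourProb_mul hq ω fun _ => 1
    simp only [mul_one] at h
    rw [h]
    exact avg_dens hq ω
  refine ⟨fun σ τ => ?_, fun σ => ?_, fun σ => div_pos (hw σ) hZ, ?_, fun σ τ => ?_⟩
  · refine Finset.sum_nonneg fun ω _ => mul_nonneg (mul_nonneg (pow_nonneg hp.le _)
      (pow_nonneg (by linarith) _)) ?_
    rw [recolourProb_eq hq]
    exact div_nonneg (dens_nonneg hq _ _) (pow_card_pos hq).le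
  · simp only [kernel_eq_sum_odds G hp1]
    rw [← Finset.mul_sum, Finset.sum_comm]
    simp only [← Finset.mul_sum, hdens, mul_one, sum_powerset_pow_card, one_add_odds hp1]
    rw [← mul_pow, mul_inv_cancel₀ (by linarith), one_pow]
  · simp only [potts]
    rw [← Finset.sum_div, div_self hZ.ne']
  · simp only [potts]
    rw [div_mul_eq_mul_div, div_mul_eq_mul_div, pottsWeight_mul_kernel G hq hpβ,
      pottsWeight_mul_kernel G hq hpβ]
    simp only [mul_comm (monoInd _ σ)]

end Kernel

/-! ### Space-time expansion of the powers of the kernel. -/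

section SpaceTime

variable {V : Type*} [Fintype V] [DecidableEq V] (G : SimpleGraph V) [DecidableRel G.Adj] {q : ℕ}

/-- The edges of a space-time configuration that are open at time `i`. -/
def layer (η : Finset (ℕ × Sym2 V)) (i : ℕ) : Finset (Sym2 V) :=
  (η.filter fun x => x.1 = i).image Prod.snd

lemma mem_layer {η : Finset (ℕ × Sym2 V)} {i : ℕ} {e : Sym2 V} : e ∈ layer η i ↔ (i, e) ∈ η := by
  simp [layer]

lemma layer_union (η η' : Finset (ℕ × Sym2 V)) (i : ℕ) :
    layer (η ∪ η') i = layer η i ∪ layer η' i := by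
  ext e
  simp [mem_layer]

lemma sum_card_layer {k : ℕ} {η : Finset (ℕ × Sym2 V)} (h : ∀ x ∈ η, x.1 < k) :
    ∑ i ∈ Finset.range k, (layer η i).card = η.card := by
  rw [Finset.card_eq_sum_card_fiberwise (f := Prod.fst) (t := Finset.range k)
    fun x hx => Finset.mem_coe.mpr (Finset.mem_range.mpr (h x hx))]
  refine Finset.sum_congr rfl fun i _ => Finset.card_image_of_injOn ?_
  rintro ⟨a, e⟩ ha ⟨b, f⟩ hb hab
  simp only [Finset.coe_filter, Set.mem_ofPred_eq] at ha hb
  exact Prod.ext (ha.2.trans hb.2.symm) hab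

/-- The space-time edges at times `0, …, k - 1`. -/
def spaceTime (k : ℕ) : Finset (ℕ × Sym2 V) := Finset.range k ×ˢ G.edgeFinset

lemma spaceTime_succ (k : ℕ) :
    spaceTime G (k + 1) = spaceTime G k ∪ {k} ×ˢ G.edgeFinset := by
  rw [spaceTime, spaceTime, Finset.range_add_one, Finset.insert_eq, Finset.union_comm,
    Finset.union_product]

lemma disjoint_spaceTime (k : ℕ) : Disjoint (spaceTime G k) ({k} ×ˢ G.edgeFinset) := by
  rw [Finset.disjoint_left]
  rintro ⟨i, e⟩ h1 h2
  simp only [spaceTime, Finset.mem_product, Finset.mem_range, Finset.mem_singleton] at h1 h2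
  omega

lemma sum_powerset_layer (k : ℕ) (E : Finset (Sym2 V)) (f : Finset (ℕ × Sym2 V) → ℝ) :
    ∑ b ∈ (({k} : Finset ℕ) ×ˢ E).powerset, f b = ∑ ω ∈ E.powerset, f ({k} ×ˢ ω) := by
  refine Finset.sum_nbij' (fun b => layer b k) (fun ω => {k} ×ˢ ω) ?_ ?_ ?_ ?_ ?_
  · intro b hb
    rw [Finset.mem_powerset] at hb ⊢
    exact fun e he => (Finset.mem_product.mp (hb (mem_layer.mp he))).2
  · intro ω hω
    rw [Finset.mem_powerset] at hω ⊢
    exact Finset.product_subset_product_right hω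
  · intro b hb
    rw [Finset.mem_powerset] at hb
    ext ⟨i, e⟩
    simp only [Finset.mem_product, Finset.mem_singleton, mem_layer]
    constructor
    · rintro ⟨rfl, h⟩
      exact h
    · intro h
      have := Finset.mem_singleton.mp (Finset.mem_product.mp (hb h)).1
      simp only at this
      subst this
      exact ⟨rfl, h⟩
  · intro ω _
    ext e
    simp [mem_layer]
  · intro b hb
    rw [Finset.mem_powerset] at hb
    congr 1
    ext ⟨i, e⟩
    simp only [Finset.mem_product, Finset.mem_singleton, mem_layer]
    constructor
    · intro h
      have := Finset.mem_singleton.mp (Finset.mem_product.mp (hb h)).1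
      simp only at this
      subst this
      exact ⟨rfl, h⟩
    · rintro ⟨rfl, h⟩
      exact h

lemma layer_singleton_product (k i : ℕ) (ω : Finset (Sym2 V)) :
    layer ({k} ×ˢ ω) i = if i = k then ω else ∅ := by
  ext e
  rw [mem_layer, Finset.mem_product, Finset.mem_singleton]
  split_ifs with h <;> simp [h]

/-- Space-time expansion of the transition probabilities. -/
lemma kernel_pow_eq (hq : 0 < q) {p : ℝ} (hp1 : p < 1) (k : ℕ) (x y : V → Fin q) :
    (q : ℝ) ^ Fintype.card V * (kernel G q p ^ (k + 1)) x y =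
      ((1 - p) ^ G.edgeFinset.card) ^ (k + 1) *
        ∑ η ∈ (spaceTime G (k + 1)).powerset,
          (p / (1 - p)) ^ η.card * pathDens (layer η) y k x := by
  have hpos := pow_card_pos (V := V) hq
  induction k generalizing x with
  | zero =>
    have h0 : spaceTime G (0 + 1) = {0} ×ˢ G.edgeFinset := rfl
    rw [h0, sum_powerset_layer, zero_add, pow_one, pow_one, kernel_eq_sum_odds G hp1,
      mul_left_comm]
    congr 1
    rw [Finset.mul_sum]
    refine Finset.sum_congr rfl fun ω _ => ?_
    rw [recolourProb_eq hq, pathDens, layer_singleton_product, if_pos rfl, Finset.card_product,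
      Finset.card_singleton, one_mul]
    field_simp
  | succ k ih =>
    rw [spaceTime_succ, sum_powerset_union (disjoint_spaceTime G (k + 1))]
    -- The new top layer `ω` is the first step, from `x` to `τ`; the lower layers `a` are the
    -- history started at `τ`.
    have hterm : ∀ a ∈ (spaceTime G (k + 1)).powerset, ∀ ω : Finset (Sym2 V),
        (p / (1 - p)) ^ (a ∪ {k + 1} ×ˢ ω).card *
          pathDens (layer (a ∪ {k + 1} ×ˢ ω)) y (k + 1) x =
        ∑ τ, ((p / (1 - p)) ^ ω.card * recolourProb (keep ω x) τ) *
          ((p / (1 - p)) ^ a.card * pathDens (layer a) y k τ) := by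
      intro a ha ω
      rw [Finset.mem_powerset] at ha
      have ha' : ∀ e ∈ a, e.1 < k + 1 := fun e he =>
        Finset.mem_range.mp (Finset.mem_product.mp (ha he)).1
      have hd : Disjoint a ({k + 1} ×ˢ ω) := by
        rw [Finset.disjoint_left]
        intro e he h
        have h1 := Finset.mem_singleton.mp (Finset.mem_product.mp h).1
        have h2 := ha' e he
        omega
      have htop : layer (a ∪ {k + 1} ×ˢ ω) (k + 1) = ω := by
        have h0 : layer a (k + 1) = ∅ := by
          refine Finset.eq_empty_of_forall_notMem fun e he => ?_
          exact absurd (ha' _ (mem_layer.mp he)) (lt_irrefl _)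
        rw [layer_union, layer_singleton_product, if_pos rfl, h0, Finset.empty_union]
      have hlow : ∀ i ≤ k, layer (a ∪ {k + 1} ×ˢ ω) i = layer a i := by
        intro i hi
        rw [layer_union, layer_singleton_product, if_neg (by omega), Finset.union_empty]
      rw [pathDens, htop, Finset.card_union_of_disjoint hd, Finset.card_product,
        Finset.card_singleton, one_mul, ← sum_recolourProb_mul hq, Finset.mul_sum]
      refine Finset.sum_congr rfl fun τ _ => ?_
      rw [pathDens_congr y k hlow, pow_add]
      ring
    have hsum : ∑ a ∈ (spaceTime G (k + 1)).powerset,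
        ∑ b ∈ (({k + 1} : Finset ℕ) ×ˢ G.edgeFinset).powerset,
          (p / (1 - p)) ^ (a ∪ b).card * pathDens (layer (a ∪ b)) y (k + 1) x =
        ∑ τ, (∑ ω ∈ G.edgeFinset.powerset,
          (p / (1 - p)) ^ ω.card * recolourProb (keep ω x) τ) *
          ∑ a ∈ (spaceTime G (k + 1)).powerset,
            (p / (1 - p)) ^ a.card * pathDens (layer a) y k τ := by
      simp only [Finset.sum_mul_sum]
      rw [Finset.sum_comm (s := Finset.univ)]
      simp only [sum_powerset_layer]
      rw [Finset.sum_comm]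
      refine Finset.sum_congr rfl fun ω _ => ?_
      rw [Finset.sum_comm (s := Finset.univ)]
      exact Finset.sum_congr rfl fun a ha => hterm a ha ω
    rw [hsum, pow_succ', Matrix.mul_apply, Finset.mul_sum, Finset.mul_sum]
    refine Finset.sum_congr rfl fun τ _ => ?_
    rw [mul_left_comm, ih, kernel_eq_sum_odds G hp1]
    ring

end SpaceTime

/-! ### Comparing two starting states. -/

section Comparison

variable {V : Type*} [Fintype V] [DecidableEq V] (G : SimpleGraph V) [DecidableRel G.Adj] {q : ℕ}

/-- Space-time edges at distance at most one in time that share an endpoint. -/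
def stNeighbours (x : ℕ × Sym2 V) : Finset (ℕ × Sym2 V) :=
  Finset.Icc (x.1 - 1) (x.1 + 1) ×ˢ
    G.edgeFinset.filter fun f => x.2 ∈ G.edgeFinset ∧ ∃ v ∈ x.2, v ∈ f

lemma mem_stNeighbours {x z : ℕ × Sym2 V} : z ∈ stNeighbours G x ↔
    (x.1 ≤ z.1 + 1 ∧ z.1 ≤ x.1 + 1) ∧ z.2 ∈ G.edgeFinset ∧ x.2 ∈ G.edgeFinset ∧
      ∃ v ∈ x.2, v ∈ z.2 := by
  rw [stNeighbours, Finset.mem_product, Finset.mem_Icc, Finset.mem_filter, tsub_le_iff_right]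

/-- Symmetry is why `stNeighbours` requires `x.2` to be an edge as well. -/
lemma stNeighbours_symm (x z : ℕ × Sym2 V) (h : z ∈ stNeighbours G x) : x ∈ stNeighbours G z := by
  rw [mem_stNeighbours] at h ⊢
  obtain ⟨⟨h1, h2⟩, h3, h4, v, h5, h6⟩ := h
  exact ⟨⟨h2, h1⟩, h4, h3, v, h6, h5⟩

/-- At most three times, and at most `2 * d` edges touching a given edge. -/
lemma card_stNeighbours_le {d : ℕ} (hG : ∀ v, G.degree v ≤ d) (x : ℕ × Sym2 V) :
    (stNeighbours G x).card ≤ 6 * d := by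
  obtain ⟨i, e⟩ := x
  rw [stNeighbours, Finset.card_product, Nat.card_Icc]
  have h1 : (G.edgeFinset.filter fun f => e ∈ G.edgeFinset ∧ ∃ v ∈ e, v ∈ f).card ≤ 2 * d := by
    induction e with
    | h u v =>
      calc _ ≤ (G.incidenceFinset u ∪ G.incidenceFinset v).card := by
            refine Finset.card_le_card fun f hf => ?_
            rw [Finset.mem_filter] at hf
            obtain ⟨hf, -, w, hw, hwf⟩ := hf
            rw [Finset.mem_union, mem_incidenceFinset, mem_incidenceFinset]
            rw [mem_edgeFinset] at hf
            rcases Sym2.mem_iff.mp hw with rfl | rfl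
            · exact Or.inl ⟨hf, hwf⟩
            · exact Or.inr ⟨hf, hwf⟩
        _ ≤ G.degree u + G.degree v := by
            refine (Finset.card_union_le _ _).trans ?_
            rw [card_incidenceFinset_eq_degree, card_incidenceFinset_eq_degree]
        _ ≤ 2 * d := by linarith [hG u, hG v]
  calc _ ≤ 3 * (2 * d) := Nat.mul_le_mul (by omega) h1
    _ = 6 * d := by ring

variable {G}

/-- Histories factorize over non-adjacent space-time configurations. -/
lemma pathDens_layer_union (hq : 0 < q) {S T : Finset (ℕ × Sym2 V)} {K : ℕ}
    (hS : S ⊆ spaceTime G K) (hT : T ⊆ spaceTime G K)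
    (h : ∀ e ∈ S, ∀ f ∈ T, f ∉ stNeighbours G e) (y : V → Fin q) (k : ℕ) (σ : V → Fin q) :
    pathDens (layer (S ∪ T)) y k σ = pathDens (layer S) y k σ * pathDens (layer T) y k σ := by
  have hd : ∀ i j, i ≤ j + 1 → j ≤ i + 1 → Disjoint (verts (layer S i)) (verts (layer T j)) := by
    intro i j hij hji
    rw [Set.disjoint_left]
    rintro v ⟨e, he, hve⟩ ⟨f, hf, hvf⟩
    rw [mem_layer] at he hf
    refine h _ he _ hf ((mem_stNeighbours G).mpr ⟨⟨hij, hji⟩, ?_, ?_, v, hve, hvf⟩)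
    · exact (Finset.mem_product.mp (hT hf)).2
    · exact (Finset.mem_product.mp (hS he)).2
  rw [← pathDens_union hq (layer S) (layer T) y k (fun i _ => hd i i (by omega) (by omega))
    (fun i _ => hd i (i + 1) (by omega) (by omega)) fun i _ => hd (i + 1) i (by omega) (by omega)]
  exact pathDens_congr y k (fun i _ => layer_union S T i) σ

/-- The part of a configuration that does not connect time `0` to time `k` yields a density that
does not depend on the starting state. -/
lemma exists_split (hq : 0 < q) (y : V → Fin q) (k : ℕ) {η : Finset (ℕ × Sym2 V)}
    (hη : η ⊆ spaceTime G (k + 1)) :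
    ∃ S ⊆ η,
      (∀ σ, pathDens (layer η) y k σ =
        pathDens (layer S) y k σ * pathDens (layer (η \ S)) y k σ) ∧
      (∀ σ σ', pathDens (layer (η \ S)) y k σ = pathDens (layer (η \ S)) y k σ') ∧
      ∃ R ⊆ (spaceTime G (k + 1)).filter (fun e => e.1 = 0),
        Rooted (stNeighbours G) R S ∧ (k + 1) * R.card ≤ S.card := by
  obtain ⟨S, hS, A, hA, h1, h2, h3, h4, R, hR, hRS, hcard⟩ :=
    exists_crossing_decomposition (nb := stNeighbours G) (stNeighbours_symm G) Prod.fst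
      (fun e f h => ((mem_stNeighbours G).mp h).1.2) k η
  have hT : η \ S ⊆ spaceTime G (k + 1) := Finset.sdiff_subset.trans hη
  refine ⟨S, hS, fun σ => ?_, fun σ σ' => ?_, R,
    hR.trans (Finset.filter_subset_filter _ hη), hRS, hcard⟩
  · rw [← pathDens_layer_union hq (hS.trans hη) hT h1, Finset.union_sdiff_of_subset hS]
  -- The clusters in `A` reach layer `k` but not layer `0`, so their factor is 1; the others miss
  -- layer `k` and do not see the start.
  · have hsplit : ∀ σ, pathDens (layer (η \ S)) y k σ =
        pathDens (layer ((η \ S) \ A)) y k σ := by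
      intro σ
      conv_lhs => rw [← Finset.union_sdiff_of_subset hA]
      rw [pathDens_layer_union hq (hA.trans hT) (Finset.sdiff_subset.trans hT) h2,
        pathDens_eq_one hq (layer A), one_mul]
      refine Finset.eq_empty_of_forall_notMem fun e he => ?_
      exact h3 _ (mem_layer.mp he) rfl
    rw [hsplit, hsplit]
    refine pathDens_eq_of_empty _ y k (Finset.eq_empty_of_forall_notMem fun e he => ?_) σ σ'
    exact h4 _ (mem_layer.mp he) rfl

variable (G)

/-- Comparison of the transition probabilities from two starting states. -/
lemma kernel_pow_le (hq : 0 < q) {p c : ℝ} (hp : 0 < p) (hp1 : p < 1) (hc : 0 ≤ c) {d : ℕ}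
    (hG : ∀ v, G.degree v ≤ d) (hpc : 8 * (p / (1 - p)) * (1 + c) ^ (6 * d) ≤ c) {k : ℕ}
    (hqk : q ^ 2 ≤ 2 ^ (k + 1)) (x x' y : V → Fin q) :
    (kernel G q p ^ (k + 1)) x y ≤
      (1 + (1 / 2) ^ (k + 1) * (1 + c)) ^ G.edgeFinset.card * (kernel G q p ^ (k + 1)) x' y := by
  classical
  set z := p / (1 - p)
  have hz : 0 ≤ z := div_nonneg hp.le (by linarith)
  set X := spaceTime G (k + 1)
  set B := X.filter fun e => e.1 = 0
  set D := (1 + (1 / 2 : ℝ) ^ (k + 1) * (1 + c)) ^ G.edgeFinset.card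
  have hBcard : B.card ≤ G.edgeFinset.card := by
    calc B.card ≤ (({0} : Finset ℕ) ×ˢ G.edgeFinset).card := by
          refine Finset.card_le_card fun e he => ?_
          obtain ⟨he, h0⟩ := Finset.mem_filter.mp he
          exact Finset.mem_product.mpr ⟨Finset.mem_singleton.mpr h0, (Finset.mem_product.mp he).2⟩
      _ = G.edgeFinset.card := by rw [Finset.card_product, Finset.card_singleton, one_mul]
  let good := X.powerset.filter fun S =>
    ∃ R ⊆ B, Rooted (stNeighbours G) R S ∧ (k + 1) * R.card ≤ S.card
  -- Here `a = 4 * z` and `θ = 1 / 2`, so `a / θ` is the `8 * z` of `hpc`.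
  have hgood : ∑ S ∈ good, (4 * z) ^ S.card ≤ D := by
    refine (sum_rooted_large_le (stNeighbours_symm G) (card_stNeighbours_le G hG)
      (by positivity : 0 ≤ 4 * z) hc (by norm_num : (0 : ℝ) < 1 / 2) (by norm_num) ?_ X B
      (k + 1)).trans ?_
    · calc _ = 8 * z * (1 + c) ^ (6 * d) := by ring
        _ ≤ c := hpc
    · refine pow_le_pow_right₀ ?_ hBcard
      have : 0 ≤ (1 / 2 : ℝ) ^ (k + 1) * (1 + c) := by positivity
      linarith
  have hsplit : ∀ η : Finset (ℕ × Sym2 V), ∃ S, η ∈ X.powerset → (S ⊆ η ∧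
      (∀ σ, pathDens (layer η) y k σ =
        pathDens (layer S) y k σ * pathDens (layer (η \ S)) y k σ) ∧
      (∀ σ σ', pathDens (layer (η \ S)) y k σ = pathDens (layer (η \ S)) y k σ') ∧
      ∃ R ⊆ B, Rooted (stNeighbours G) R S ∧ (k + 1) * R.card ≤ S.card) := by
    intro η
    by_cases hη : η ∈ X.powerset
    · obtain ⟨S, h⟩ := exists_split hq y k (Finset.mem_powerset.mp hη)
      exact ⟨S, fun _ => h⟩
    · exact ⟨∅, fun h => absurd h hη⟩
  choose cr hcr using hsplit
  let F : Finset (ℕ × Sym2 V) × Finset (ℕ × Sym2 V) → ℝ := fun ST =>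
    (4 * z) ^ ST.1.card * (z ^ ST.2.card * pathDens (layer ST.2) y k x')
  have hF : ∀ ST, 0 ≤ F ST := fun ST =>
    mul_nonneg (by positivity) (mul_nonneg (by positivity) (pathDens_nonneg hq _ _ _ _))
  have hterm : ∀ η ∈ X.powerset, z ^ η.card * pathDens (layer η) y k x ≤ F (cr η, η \ cr η) := by
    intro η hη
    obtain ⟨h1, h2, h3, -⟩ := hcr η hη
    have hcard : η.card = (cr η).card + (η \ cr η).card := by
      rw [add_comm, Finset.card_sdiff_add_card_eq_card h1]
    have h4 : pathDens (layer (cr η)) y k x ≤ 4 ^ (cr η).card := by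
      have h5 := pathDens_le_four_pow hq (layer (cr η)) y hqk x
      rwa [sum_card_layer] at h5
      exact fun e he => Finset.mem_range.mp
        (Finset.mem_product.mp (Finset.mem_powerset.mp hη (h1 he))).1
    rw [h2, h3 x x', hcard, pow_add]
    simp only [F, mul_pow]
    calc _ = pathDens (layer (cr η)) y k x * (z ^ (cr η).card *
          (z ^ (η \ cr η).card * pathDens (layer (η \ cr η)) y k x')) := by ring
      _ ≤ 4 ^ (cr η).card * (z ^ (cr η).card *
          (z ^ (η \ cr η).card * pathDens (layer (η \ cr η)) y k x')) :=
        mul_le_mul_of_nonneg_right h4 (mul_nonneg (by positivity)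
          (mul_nonneg (by positivity) (pathDens_nonneg hq _ _ _ _)))
      _ = _ := by ring
  have hinj : Set.InjOn (fun η => (cr η, η \ cr η)) (X.powerset : Set (Finset (ℕ × Sym2 V))) := by
    intro η hη η' hη' h
    have h1 := (Prod.mk.injEq _ _ _ _).mp h
    exact (Finset.union_sdiff_of_subset (hcr η hη).1).symm.trans
      ((congrArg₂ (· ∪ ·) h1.1 h1.2).trans (Finset.union_sdiff_of_subset (hcr η' hη').1))
  have hZ : ∑ η ∈ X.powerset, z ^ η.card * pathDens (layer η) y k x ≤
      D * ∑ η ∈ X.powerset, z ^ η.card * pathDens (layer η) y k x' := by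
    calc ∑ η ∈ X.powerset, z ^ η.card * pathDens (layer η) y k x
        ≤ ∑ η ∈ X.powerset, F (cr η, η \ cr η) := Finset.sum_le_sum hterm
      _ = ∑ ST ∈ X.powerset.image fun η => (cr η, η \ cr η), F ST :=
          (Finset.sum_image hinj).symm
      -- As the terms are nonnegative, the crossing part and the rest may range independently, which
      -- factorizes the sum.
      _ ≤ ∑ ST ∈ good ×ˢ X.powerset, F ST := by
          refine Finset.sum_le_sum_of_subset_of_nonneg ?_ fun ST _ _ => hF ST
          intro ST hST
          obtain ⟨η, hη, rfl⟩ := Finset.mem_image.mp hST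
          obtain ⟨h1, -, -, h4⟩ := hcr η hη
          have hηX := Finset.mem_powerset.mp hη
          exact Finset.mem_product.mpr ⟨Finset.mem_filter.mpr
            ⟨Finset.mem_powerset.mpr (h1.trans hηX), h4⟩,
            Finset.mem_powerset.mpr (Finset.sdiff_subset.trans hηX)⟩
      _ = (∑ S ∈ good, (4 * z) ^ S.card) *
          ∑ η ∈ X.powerset, z ^ η.card * pathDens (layer η) y k x' := by
          rw [Finset.sum_mul_sum, Finset.sum_product]
      _ ≤ _ := mul_le_mul_of_nonneg_right hgood (Finset.sum_nonneg fun η _ =>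
          mul_nonneg (by positivity) (pathDens_nonneg hq _ _ _ _))
  have hpos := pow_card_pos (V := V) hq
  refine le_of_mul_le_mul_left ?_ hpos
  rw [mul_left_comm, kernel_pow_eq G hq hp1, kernel_pow_eq G hq hp1, mul_left_comm]
  exact mul_le_mul_of_nonneg_left hZ (pow_nonneg (pow_nonneg (by linarith) _) _)

end Comparison

/-! ### Choice of constants at high temperature. -/

lemma card_edgeFinset_le {V : Type*} [Fintype V] [DecidableEq V] (G : SimpleGraph V)
    [DecidableRel G.Adj] {d : ℕ} (hG : ∀ v, G.degree v ≤ d) :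
    G.edgeFinset.card ≤ Fintype.card V * d := by
  have h1 := G.sum_degrees_eq_twice_card_edges
  have h2 : ∑ v, G.degree v ≤ Fintype.card V * d := by
    simpa using Finset.sum_le_card_nsmul Finset.univ (fun v => G.degree v) d
      fun v _ => hG v
  omega

/-- Uniform upper bound on the transition probabilities by the Potts measure after order `log n`
steps at high temperature. -/
lemma kernel_pow_le_five_mul_potts {V : Type*} [Fintype V] [DecidableEq V] (G : SimpleGraph V)
    [DecidableRel G.Adj] {q d t : ℕ} (hq : 0 < q) (hd : 0 < d) {p β : ℝ} (hp : 0 < p)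
    (hpd : p < 1 / (288 * d)) (hpβ : p = 1 - Real.exp (-β)) (hG : ∀ v, G.degree v ≤ d)
    (hn : 6 * d ≤ Fintype.card V) (hnq : 2 * q ≤ Fintype.card V)
    (ht : (Fintype.card V : ℝ) ^ 2 ≤ 3 * 4 ^ t) (x y : V → Fin q) :
    (kernel G q p ^ (2 * t)) x y ≤ 5 * potts G β y := by
  have hd1 : (1 : ℝ) ≤ d := by exact_mod_cast hd
  have hn' : 6 * (d : ℝ) ≤ Fintype.card V := by exact_mod_cast hn
  have hnq' : 2 * (q : ℝ) ≤ Fintype.card V := by exact_mod_cast hnq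
  have hp1 : p < 1 := by linarith [Real.exp_pos (-β)]
  have hpd' : p * (288 * d) < 1 := (lt_div_iff₀ (by positivity)).mp hpd
  have he3 : Real.exp 1 ≤ 3 := by linarith [Real.exp_one_lt_d9]
  obtain ⟨k, hk⟩ : ∃ k, 2 * t = k + 1 := by
    refine Nat.exists_eq_succ_of_ne_zero fun h0 => ?_
    have : t = 0 := by omega
    rw [this] at ht
    nlinarith
  set n : ℝ := (Fintype.card V : ℝ)
  have hn0 : 0 < n := by linarith
  have h4 : (2 : ℝ) ^ (k + 1) = 4 ^ t := by
    rw [← hk, pow_mul]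
    norm_num
  -- Since `2q ≤ n`, one has `q² ≤ n²/4 ≤ (3/4) 4^t`.
  have hqk : q ^ 2 ≤ 2 ^ (k + 1) := by
    have hq0 : (0 : ℝ) ≤ q := Nat.cast_nonneg q
    have : (q : ℝ) ^ 2 ≤ 2 ^ (k + 1) := by
      rw [h4]
      nlinarith
    exact_mod_cast this
  -- The choice `c = 1/(6d)` keeps `(1 + c)^(6d)` below `e ≤ 3`. As `p/(1-p) ≤ 2p`, the left side is
  -- at most `48p`, and `48p ≤ 1/(6d)` amounts to `p ≤ 1/(288d)`.
  have hpc : 8 * (p / (1 - p)) * (1 + 1 / (6 * d : ℝ)) ^ (6 * d) ≤ 1 / (6 * d) := by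
    have hp2 : p ≤ 1 / 2 := by nlinarith
    have hz : p / (1 - p) ≤ 2 * p := by
      rw [div_le_iff₀ (by linarith)]
      nlinarith
    have hc : (1 + 1 / (6 * d : ℝ)) ^ (6 * d) ≤ 3 := by
      calc (1 + 1 / (6 * d : ℝ)) ^ (6 * d) ≤ Real.exp (1 / (6 * d)) ^ (6 * d) := by
            refine pow_le_pow_left₀ (by positivity) ?_ _
            rw [add_comm]
            exact Real.add_one_le_exp _
        _ = Real.exp 1 := by
            rw [← Real.exp_nat_mul]
            congr 1
            push_cast
            field_simp
        _ ≤ 3 := he3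
    calc 8 * (p / (1 - p)) * (1 + 1 / (6 * d : ℝ)) ^ (6 * d) ≤ 8 * (2 * p) * 3 := by
          refine mul_le_mul (by linarith) hc (by positivity) (by positivity)
      _ ≤ 1 / (6 * d) := by
          rw [le_div_iff₀ (by positivity)]
          linarith
  -- With at most `nd` edges and `2^(-(k+1)) ≤ 3/n²`, the exponent is at most `6d/n ≤ 1`.
  have hD : (1 + (1 / 2 : ℝ) ^ (k + 1) * (1 + 1 / (6 * d))) ^ G.edgeFinset.card ≤ 5 := by
    have hc2 : 1 + 1 / (6 * d : ℝ) ≤ 2 := by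
      have : 1 / (6 * d : ℝ) ≤ 1 := by
        rw [div_le_one (by positivity)]
        linarith
      linarith
    have hθ : (1 / 2 : ℝ) ^ (k + 1) ≤ 3 / n ^ 2 := by
      rw [one_div, inv_pow, h4, le_div_iff₀ (by positivity), inv_mul_le_iff₀ (by positivity)]
      linarith
    have hE : (G.edgeFinset.card : ℝ) ≤ n * d := by
      have := card_edgeFinset_le G hG
      simp only [n]
      exact_mod_cast this
    calc (1 + (1 / 2 : ℝ) ^ (k + 1) * (1 + 1 / (6 * d))) ^ G.edgeFinset.card
        ≤ Real.exp (3 / n ^ 2 * 2) ^ G.edgeFinset.card := by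
          refine pow_le_pow_left₀ (by positivity) ?_ _
          rw [add_comm]
          refine le_trans ?_ (Real.add_one_le_exp _)
          gcongr
      _ = Real.exp (G.edgeFinset.card * (3 / n ^ 2 * 2)) := (Real.exp_nat_mul _ _).symm
      _ ≤ Real.exp 1 := by
          refine Real.exp_le_exp.mpr ?_
          calc G.edgeFinset.card * (3 / n ^ 2 * 2) ≤ n * d * (3 / n ^ 2 * 2) := by gcongr
            _ = 6 * d / n := by field_simp; ring
            _ ≤ 1 := by rwa [div_le_one hn0]
      _ ≤ 5 := by linarith
  have hP := isReversibleChain_kernel G hq hp hpβ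
  have hnn : ∀ x' : V → Fin q, 0 ≤ (kernel G q p ^ (k + 1)) x' y := by
    intro x'
    have hpos := pow_card_pos (V := V) hq
    refine nonneg_of_mul_nonneg_right (b := (kernel G q p ^ (k + 1)) x' y) ?_ hpos
    rw [kernel_pow_eq G hq hp1]
    refine mul_nonneg (pow_nonneg (pow_nonneg (by linarith) _) _) (Finset.sum_nonneg fun η _ => ?_)
    exact mul_nonneg (pow_nonneg (div_nonneg hp.le (by linarith)) _) (pathDens_nonneg hq _ _ _ _)
  rw [hk]
  -- Average the comparison over `x'` distributed as the stationary law.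
  calc (kernel G q p ^ (k + 1)) x y
      = ∑ x', potts G β x' * (kernel G q p ^ (k + 1)) x y := by
        rw [← Finset.sum_mul, hP.sum_eq_one, one_mul]
    _ ≤ ∑ x', potts G β x' * (5 * (kernel G q p ^ (k + 1)) x' y) := by
        refine Finset.sum_le_sum fun x' _ => mul_le_mul_of_nonneg_left ?_ (hP.pos x').le
        exact (kernel_pow_le G hq hp hp1 (by positivity) hG hpc hqk x x' y).trans
          (mul_le_mul_of_nonneg_right hD (hnn x'))
    _ = 5 * potts G β y := by
        simp only [mul_left_comm _ (5 : ℝ)]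
        rw [← Finset.mul_sum, hP.stationary_pow]

end SwendsenWang

theorem mainTheorem4 (d : ℕ) (hd : 2 ≤ d) :
    ∃ p₀ : ℝ, 0 < p₀ ∧
      ∀ p β : ℝ, 0 < p → p < p₀ → p = 1 - Real.exp (-β) →
        ∃ C : ℝ, 0 < C ∧
          ∀ q : ℕ, 2 ≤ q →
            ∃ N : ℕ, ∀ n : ℕ, N ≤ n →
              ∀ (V : Type*) [Fintype V] [DecidableEq V]
                (G : SimpleGraph V) [DecidableRel G.Adj],
                Fintype.card V = n → G.IsRegularOfDegree d → SwendsenWang.IsTransitive G →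
                  ∀ t : ℕ, C * Real.log n ≤ t →
                    SwendsenWang.worstL2Dist (SwendsenWang.kernel G q p)
                        (SwendsenWang.potts G β) t ≤
                      2 * Real.exp
                        (-Real.log (1 / (1 - SwendsenWang.spectralGap
                            (SwendsenWang.kernel G q p))) * (t - C * Real.log n)) := by
  have hd0 : 0 < d := by omega
  -- `C = 2` works for all `d` and `p`; `N` ensures `6d ≤ n` and `2q ≤ n`.
  refine ⟨1 / (288 * d), by positivity, fun p β hp hpd hpβ => ⟨2, two_pos, fun q hq =>
    ⟨6 * d + 2 * q, fun n hn V _ _ G _ hV hG _ t ht => ?_⟩⟩⟩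
  subst hV
  have hq0 : 0 < q := by omega
  have hP := SwendsenWang.isReversibleChain_kernel (q := q) G hq0 hp hpβ
  have hn1 : (1 : ℝ) ≤ Fintype.card V := by exact_mod_cast (by omega : 1 ≤ Fintype.card V)
  have hn0 : (0 : ℝ) < Fintype.card V := by linarith
  have hlog : 0 ≤ 2 * Real.log (Fintype.card V) := by
    have := Real.log_nonneg hn1
    linarith
  have hcard : 1 < Fintype.card (V → Fin q) := by
    rw [Fintype.card_fun, Fintype.card_fin]
    exact one_lt_pow₀ (by omega) (by omega)
  refine hP.worstL2Dist_le hcard ⌊2 * Real.log (Fintype.card V)⌋₊ t _ (Nat.floor_le hlog) ht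
    fun x => hP.l2Dist_le_two _ x ?_
  refine SwendsenWang.kernel_pow_le_five_mul_potts G hq0 hd0 hp hpd hpβ (fun v => (hG v).le)
    (by omega) (by omega) ?_ x x
  set s := ⌊2 * Real.log (Fintype.card V)⌋₊
  have hs : 2 * Real.log (Fintype.card V) < s + 1 := Nat.lt_floor_add_one _
  have he3 : Real.exp 1 ≤ 3 := by linarith [Real.exp_one_lt_d9]
  -- Rounding `2 log n` down to `s` loses a factor of at most `e ≤ 3`.
  calc (Fintype.card V : ℝ) ^ 2 = Real.exp (2 * Real.log (Fintype.card V)) := by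
        rw [two_mul, Real.exp_add, Real.exp_log hn0, sq]
    _ ≤ Real.exp (s + 1) := Real.exp_le_exp.mpr hs.le
    _ = Real.exp 1 * Real.exp 1 ^ s := by
        rw [Real.exp_add, ← Real.exp_nat_mul, mul_one, mul_comm]
    _ ≤ 3 * 4 ^ s := by
        gcongr
        linarith
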